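/- Let $G$ be a finite simple graph on $n$ vertices. An ordering of $G$ is a bijection $\phi : V(G) \to \{1,\dots,n\}$, its cost is $\mu_G(\phi)=\sum_{\{u,v\}\in E(G)} \min\{\phi(u),\phi(v)\}$, and $\phi$ is optimal if its cost is minimum among all orderings. Minimum Sum Vertex Cover is the problem of finding an optimal ordering of a given graph. Let $k$ be the minimum size of a vertex cover of $G$. (1) There is a single algorithm (a program for a random access machine with unit cost, whose arithmetic consists of setting, copying, incrementing, decrementing and comparing numbers) that, given the adjacency matrix of any graph $G$, outputs an optimal ordering of $G$ in time $$\bigl[k!\,(k+1)^{2^k} + 1.2738^k\bigr]\cdot n^{O(1)},$$ and hence in time $2^{2^{O(k)}}\, n^{O(1)}$. That is, there are constants $C,c,d$ such that for all $G$ the number of steps is at most $C\,[k!(k+1)^{2^k} + 1.2738^k]\,(n+1)^c$ and at most $C\,2^{2^{dk}}\,(n+1)^c$. (2) Let $S$ be a minimum vertex cover of $G$, $|S|=k$. Call two vertices of $V(G)\setminus S$ equivalent if they have the same neighbourhood in $S$. In an ordering $\phi$, the elements of $S$ separate the other vertices into $k+1$ blocks (block $j+1$ consists of the vertices outside $S$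 that are preceded by exactly $j$ elements of $S$), and the right degree of a vertex is the number of its neighbours that come later in $\phi$. A configuration consists of a linear order of $S$ and of a block assigned to every equivalence class. An ordering realizes the configuration if it orders $S$ as prescribed, every equivalence class lies in its assigned block and is consecutive, and in every block the right degrees of the vertices outside $S$ are non-increasing. Then there is a configuration that is realized by some ordering and such that every ordering that realizes it is optimal. -/

import Mathlib

/-! ## Minimum sum vertex cover

An ordering of an `n`-vertex graph is a bijection `φ : V ≃ Fin n`; the vertex `v` has location
`φ v + 1 ∈ {1, …, n}`. -/

namespace MSVC

variable {V : Type*} {n : ℕ}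

/-- The weight of an edge: the smaller one of the locations (counted from `1`) of its ends. -/
def edgeWeight (φ : V ≃ Fin n) : Sym2 V → ℕ :=
  Sym2.lift ⟨fun u v => min ((φ u : ℕ) + 1) ((φ v : ℕ) + 1), fun _ _ => min_comm _ _⟩

open Classical in
/-- The cost of an ordering: the sum of the weights of all edges. -/
noncomputable def cost [Fintype V] (G : SimpleGraph V) (φ : V ≃ Fin n) : ℕ :=
  ∑ e ∈ G.edgeFinset, edgeWeight φ e

/-- An ordering of minimum cost, that is, a minimum sum vertex cover. -/
def IsOptimal [Fintype V] (G : SimpleGraph V) (φ : V ≃ Fin n) : Prop :=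
  ∀ ψ : V ≃ Fin n, cost G φ ≤ cost G ψ

/-- The right degree of a vertex: the number of its neighbours that come later in the ordering. -/
noncomputable def rightDegree (G : SimpleGraph V) (φ : V ≃ Fin n) (v : V) : ℕ :=
  {u : V | G.Adj v u ∧ φ v < φ u}.ncard

/-- The neighbourhood of `u` in `S`. Two vertices outside `S` are equivalent if they have the
same neighbourhood in `S`, so the classes are indexed by (some of) the subsets of `S`. -/
def nbhd (G : SimpleGraph V) (S : Finset V) (u : V) : Set S :=
  {v : S | G.Adj u v}

/-- The (zero-based) index of the block of `u`: the number of elements of `S` before `u`. -/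
def blockIndex (S : Finset V) (φ : V ≃ Fin n) (u : V) : ℕ :=
  (S.filter fun v => φ v < φ u).card

/-- A configuration consists of an order `σ` of the set `S` and of a choice `c` of one of the
`|S| + 1` blocks for every class. `Realizes G S σ c φ` says that the ordering `φ` is built from the
configuration by putting the vertices of every class next to each other in the chosen block, the
classes of a block being arranged such that their right degrees are non-increasing. -/
structure Realizes (G : SimpleGraph V) (S : Finset V) (σ : S ≃ Fin S.card)
    (c : Set S → Fin (S.card + 1)) (φ : V ≃ Fin n) : Prop where
  order : ∀ u v : S, φ u < φ v ↔ σ u < σ v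
  block : ∀ u, u ∉ S → blockIndex S φ u = c (nbhd G S u)
  consecutive : ∀ u w, u ∉ S → w ∉ S → nbhd G S u = nbhd G S w →
    ∀ x, φ u < φ x → φ x < φ w → x ∉ S ∧ nbhd G S x = nbhd G S u
  sorted : ∀ u w, u ∉ S → w ∉ S → blockIndex S φ u = blockIndex S φ w →
    φ u < φ w → rightDegree G φ w ≤ rightDegree G φ u

end MSVC

/-! ## Random access machines

A random access machine with finitely many registers and finitely many arrays (each program
mentions only finitely many of them), all of whose cells hold natural numbers. The arithmetic
instructions only set, copy, increment and decrement numbers, so every number that occurs in a run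
is bounded by the input, the constants of the program and the number of steps; every instruction
and every test costs one step. Each instruction is a constant number of instructions of any of the
usual random access machines. -/

namespace RAM

/-- Tests that compare two registers. -/
inductive Test where
  | eq (x y : ℕ)
  | lt (x y : ℕ)

/-- Programs; registers and arrays are named by natural numbers. -/
inductive Prog where
  | skip
  | const (x m : ℕ)
  | copy (x y : ℕ)
  | succ (x : ℕ)
  | pred (x : ℕ)
  | load (x a i : ℕ)
  | store (a i x : ℕ)
  | seq (p q : Prog)
  | ite (b : Test) (p q : Prog)
  | loop (b : Test) (p : Prog)

/-- The contents of the registers and of the arrays. -/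
@[ext] structure State where
  reg : ℕ → ℕ
  arr : ℕ → ℕ → ℕ

/-- The truth value of a test in a state. -/
def Test.Holds (s : State) : Test → Prop
  | .eq x y => s.reg x = s.reg y
  | .lt x y => s.reg x < s.reg y

/-- Assign the number `m` to register `x`. -/
def State.setReg (s : State) (x m : ℕ) : State :=
  { s with reg := Function.update s.reg x m }

/-- Assign the number `m` to cell `i` of array `a`. -/
def State.setArr (s : State) (a i m : ℕ) : State :=
  { s with arr := Function.update s.arr a (Function.update (s.arr a) i m) }

/-- `Exec p s s' t`: started in the state `s`, the program `p` halts in the state `s'` after exactly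
`t` steps. -/
inductive Exec : Prog → State → State → ℕ → Prop
  | skip (s : State) : Exec .skip s s 1
  | const (s : State) (x m : ℕ) : Exec (.const x m) s (s.setReg x m) 1
  | copy (s : State) (x y : ℕ) : Exec (.copy x y) s (s.setReg x (s.reg y)) 1
  | succ (s : State) (x : ℕ) : Exec (.succ x) s (s.setReg x (s.reg x + 1)) 1
  | pred (s : State) (x : ℕ) : Exec (.pred x) s (s.setReg x (s.reg x - 1)) 1
  | load (s : State) (x a i : ℕ) : Exec (.load x a i) s (s.setReg x (s.arr a (s.reg i))) 1
  | store (s : State) (a i x : ℕ) : Exec (.store a i x) s (s.setArr a (s.reg i) (s.reg x)) 1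
  | seq {p q : Prog} {s s' s'' : State} {t t' : ℕ} :
      Exec p s s' t → Exec q s' s'' t' → Exec (.seq p q) s s'' (t + t')
  | ite_true {b : Test} {p q : Prog} {s s' : State} {t : ℕ} :
      b.Holds s → Exec p s s' t → Exec (.ite b p q) s s' (t + 1)
  | ite_false {b : Test} {p q : Prog} {s s' : State} {t : ℕ} :
      ¬ b.Holds s → Exec q s s' t → Exec (.ite b p q) s s' (t + 1)
  | loop_true {b : Test} {p : Prog} {s s' s'' : State} {t t' : ℕ} :
      b.Holds s → Exec p s s' t → Exec (.loop b p) s' s'' t' →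
        Exec (.loop b p) s s'' (t + t' + 1)
  | loop_false {b : Test} {p : Prog} {s : State} :
      ¬ b.Holds s → Exec (.loop b p) s s 1

/-- Runs are deterministic: the final state and the number of steps are determined by the program
and the initial state. -/
theorem Exec.deterministic {p : Prog} {s s₁ s₂ : State} {t₁ t₂ : ℕ}
    (h₁ : Exec p s s₁ t₁) (h₂ : Exec p s s₂ t₂) : s₁ = s₂ ∧ t₁ = t₂ := by
  induction h₁ generalizing s₂ t₂ with
  | seq _ _ ih ih' =>
    cases h₂ with
    | seq g g' =>
      obtain ⟨rfl, rfl⟩ := ih g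
      obtain ⟨rfl, rfl⟩ := ih' g'
      exact ⟨rfl, rfl⟩
  | ite_true hb _ ih =>
    cases h₂ with
    | ite_true _ g => obtain ⟨rfl, rfl⟩ := ih g; exact ⟨rfl, rfl⟩
    | ite_false hb' _ => exact absurd hb hb'
  | ite_false hb _ ih =>
    cases h₂ with
    | ite_true hb' _ => exact absurd hb' hb
    | ite_false _ g => obtain ⟨rfl, rfl⟩ := ih g; exact ⟨rfl, rfl⟩
  | loop_true hb _ _ ih ih' =>
    cases h₂ with
    | loop_true _ g g' =>
      obtain ⟨rfl, rfl⟩ := ih g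
      obtain ⟨rfl, rfl⟩ := ih' g'
      exact ⟨rfl, rfl⟩
    | loop_false hb' => exact absurd hb hb'
  | loop_false hb =>
    cases h₂ with
    | loop_true hb' _ _ => exact absurd hb' hb
    | loop_false _ => exact ⟨rfl, rfl⟩
  | _ => cases h₂; exact ⟨rfl, rfl⟩

open Classical in
/-- The initial state for a graph `G` on the vertices `0, …, n - 1`: register `0` holds `n`, array
`0` holds the adjacency matrix row by row, and all other registers and cells hold `0`. -/
noncomputable def inputState {n : ℕ} (G : SimpleGraph (Fin n)) : State where
  reg x := if x = 0 then n else 0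
  arr a m := if a = 0 ∧ ∃ i j : Fin n, m = (i : ℕ) * n + j ∧ G.Adj i j then 1 else 0

/-- The final state `s` presents the ordering `φ`: cell `v` of array `1` holds the location of the
vertex `v`, counted from `1`. -/
def Outputs {n : ℕ} (s : State) (φ : Fin n ≃ Fin n) : Prop :=
  ∀ v : Fin n, s.arr 1 v = (φ v : ℕ) + 1

end RAM

/-! Charge every edge to its earlier end: the cost of `φ` is the sum of location times right degree
(`cost_eq_sum`). Charging by the orientation of another ordering can only overestimate
(`cost_le_sum`). Hence right degrees do not increase along an optimal ordering, and by the
rearrangement inequality any ordering that sorts the right degrees of an optimal one is again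
optimal (`IsOptimal.of_sorted`).

Call vertices with equal neighbourhoods twins. In an optimal ordering no common neighbour of two
twins lies between them (`IsOptimal.not_adj_between`), so twins have equal right degrees, and
breaking ties by class makes all twin classes consecutive without losing optimality
(`exists_optimal_consecutive`).

For the configurations, let `S` be a vertex cover. Every edge meets `S`, and a configuration fixes
all comparisons that involve `S`, so it fixes all right degrees. Realizations differ only inside
blocks, where each is sorted; if one is optimal, all are (`Realizes.isOptimal`).

The algorithm never computes a vertex cover. It runs a dynamic programme over the unions of twin
classes: the best ordering of a union is found by appending a class to the best ordering of a
smaller union (`ListsTwinClosed.exists_optimal`). A vertex cover of size `k` leaves at most `k + 2 ^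
k` classes, hence at most `2 ^ (k + 2 ^ k)` unions, and the time is polynomial in this number and
`n`. Every fixed power of it is absorbed by `(k + 1) ^ 2 ^ k`, because `k + 1` exceeds any constant
eventually. -/

namespace MSVC

/-! ### Exchange arguments: right degrees and twins in optimal orderings. -/

section Orderings

open Classical Finset

variable {V : Type*} {n : ℕ}

/-- Two vertices with the same neighbours. -/
def Twins (G : SimpleGraph V) (u w : V) : Prop := ∀ x, G.Adj u x ↔ G.Adj w x

theorem Twins.adj_swap {G : SimpleGraph V} {u w : V} (h : Twins G u w) (x y : V) :
    G.Adj (Equiv.swap u w x) (Equiv.swap u w y) ↔ G.Adj x y := by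
  have h' : ∀ z, G.Adj z u ↔ G.Adj z w := fun z => by rw [G.adj_comm, h, G.adj_comm]
  have hl : ∀ z, G.Adj (Equiv.swap u w x) z ↔ G.Adj x z := by
    intro z
    by_cases h1 : x = u
    · subst h1; rw [Equiv.swap_apply_left]; exact (h z).symm
    · by_cases h2 : x = w
      · subst h2; rw [Equiv.swap_apply_right]; exact h z
      · rw [Equiv.swap_apply_of_ne_of_ne h1 h2]
  rw [hl]
  by_cases h1 : y = u
  · subst h1; rw [Equiv.swap_apply_left]; exact (h' x).symm
  · by_cases h2 : y = w
    · subst h2; rw [Equiv.swap_apply_right]; exact h' x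
    · rw [Equiv.swap_apply_of_ne_of_ne h1 h2]

/-- The ordering obtained from a permutation of the locations given by an injection. -/
theorem exists_ordering_of_injective (φ : V ≃ Fin n) (g : ℕ → ℕ) (hg : ∀ i < n, g i < n)
    (hi : ∀ i j, g i = g j → i = j) : ∃ ψ : V ≃ Fin n, ∀ v, (ψ v : ℕ) = g (φ v) := by
  let f : Fin n → Fin n := fun i => ⟨g i, hg i i.2⟩
  have hf : Function.Injective f := fun i j h => Fin.ext (hi _ _ (Fin.ext_iff.1 h))
  exact ⟨φ.trans (Equiv.ofBijective f (Finite.injective_iff_bijective.1 hf)), fun v => rfl⟩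

variable [Fintype V]

/-- Twice the sum of a function over the edges is its sum over the ordered adjacent pairs. -/
theorem two_mul_sum_edgeFinset (G : SimpleGraph V) (f : Sym2 V → ℕ) :
    2 * ∑ e ∈ G.edgeFinset, f e = ∑ u, ∑ v, if G.Adj u v then f s(u, v) else 0 := by
  have h1 : ∑ d : G.Dart, f d.edge = 2 * ∑ e ∈ G.edgeFinset, f e := by
    rw [← sum_fiberwise_of_maps_to (s := univ) (t := G.edgeFinset) (g := fun d : G.Dart => d.edge)
      (fun d _ => by simp), mul_sum]
    refine sum_congr rfl fun e he => ?_
    rw [sum_congr rfl (g := fun _ => f e) (fun d hd => by rw [(mem_filter.1 hd).2]), sum_const,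
      G.dart_edge_fiber_card e (by simpa using he), smul_eq_mul]
  rw [← h1, ← sum_product', ← sum_filter]
  refine sum_bij (fun d _ => d.toProd) ?_ ?_ ?_ ?_
  · intro d _; simp
  · intro a _ b _ h; exact SimpleGraph.Dart.ext _ _ h
  · rintro ⟨u, v⟩ h
    exact ⟨⟨(u, v), by simpa using h⟩, mem_univ _, rfl⟩
  · intro d _; rfl

theorem two_mul_cost (G : SimpleGraph V) (φ : V ≃ Fin n) :
    2 * cost G φ = ∑ u, ∑ v, if G.Adj u v then min (φ u : ℕ) (φ v) + 1 else 0 := by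
  rw [cost, two_mul_sum_edgeFinset]
  refine sum_congr rfl fun u _ => sum_congr rfl fun v _ => ?_
  simp [edgeWeight, min_add_add_right]

theorem rightDegree_eq_card (G : SimpleGraph V) (φ : V ≃ Fin n) (v : V) :
    rightDegree G φ v = #{u | G.Adj v u ∧ φ v < φ u} := by
  rw [rightDegree, Set.ncard_eq_toFinset_card']
  congr 1
  ext; simp

/-- The cost of orienting all edges along `φ` and charging them to their tails, located by `ψ`. -/
theorem two_mul_sum_location_mul_rightDegree (G : SimpleGraph V) (φ ψ : V ≃ Fin n) :
    2 * ∑ v, ((ψ v : ℕ) + 1) * rightDegree G φ v =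
      ∑ u, ∑ v, if G.Adj u v then (if φ u < φ v then (ψ u : ℕ) + 1 else ψ v + 1) else 0 := by
  have h1 : ∑ v, ((ψ v : ℕ) + 1) * rightDegree G φ v =
      ∑ u, ∑ v, if G.Adj u v ∧ φ u < φ v then (ψ u : ℕ) + 1 else 0 := by
    refine sum_congr rfl fun v _ => ?_
    rw [rightDegree_eq_card, ← sum_filter, sum_const, smul_eq_mul, mul_comm]
  have h2 := h1
  rw [sum_comm] at h2
  rw [two_mul]
  nth_rewrite 1 [h1]
  rw [h2, ← sum_add_distrib]
  refine sum_congr rfl fun u _ => ?_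
  rw [← sum_add_distrib]
  refine sum_congr rfl fun v _ => ?_
  by_cases h : G.Adj u v
  · have hne : φ u ≠ φ v := fun e => h.ne (φ.injective e)
    rcases lt_or_gt_of_ne hne with h' | h'
    · simp [h, h', h'.not_gt, h.symm]
    · simp [h, h', h'.not_gt, h.symm]
  · have h' : ¬ G.Adj v u := fun e => h e.symm
    simp [h, h']

theorem cost_eq_sum (G : SimpleGraph V) (φ : V ≃ Fin n) :
    cost G φ = ∑ v, ((φ v : ℕ) + 1) * rightDegree G φ v := by
  have h := two_mul_sum_location_mul_rightDegree G φ φ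
  have h' := two_mul_cost G φ
  suffices 2 * cost G φ = 2 * ∑ v, ((φ v : ℕ) + 1) * rightDegree G φ v by omega
  rw [h, h']
  refine sum_congr rfl fun u _ => sum_congr rfl fun v _ => ?_
  split_ifs with h1 h2
  · rw [min_eq_left]; exact_mod_cast h2.le
  · rw [min_eq_right]; exact_mod_cast not_lt.1 h2
  · rfl

/-- The right degrees of any other ordering give an upper bound for the cost of an ordering. -/
theorem cost_le_sum (G : SimpleGraph V) (φ ψ : V ≃ Fin n) :
    cost G ψ ≤ ∑ v, ((ψ v : ℕ) + 1) * rightDegree G φ v := by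
  have h := two_mul_sum_location_mul_rightDegree G φ ψ
  have h' := two_mul_cost G ψ
  suffices 2 * cost G ψ ≤ 2 * ∑ v, ((ψ v : ℕ) + 1) * rightDegree G φ v by omega
  rw [h, h']
  refine sum_le_sum fun u _ => sum_le_sum fun v _ => ?_
  split_ifs <;> omega

/-- In an optimal ordering the right degrees are non-increasing. -/
theorem IsOptimal.rightDegree_le {G : SimpleGraph V} {φ : V ≃ Fin n} (h : IsOptimal G φ) {u w : V}
    (huw : φ u < φ w) : rightDegree G φ w ≤ rightDegree G φ u := by
  -- Exchange `u` and `w`, still charging edges to their tails under `φ`. The charged sum changes by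
  -- `(φ w - φ u) * (rightDegree u - rightDegree w)`, which optimality forces to be nonnegative.
  have h1 := h ((Equiv.swap u w).trans φ)
  have h2 := h1.trans (cost_le_sum G φ _)
  rw [cost_eq_sum] at h2
  have hne : u ≠ w := fun e => by simp [e] at huw
  have hw : w ∈ univ.erase u := by simp [hne.symm]
  rw [← add_sum_erase _ _ (mem_univ u), ← add_sum_erase _ _ hw,
    ← add_sum_erase (a := u) _ _ (mem_univ u), ← add_sum_erase (a := w) _ _ hw] at h2
  have h3 : ∀ x ∈ (univ.erase u).erase w,
      ((((Equiv.swap u w).trans φ) x : ℕ) + 1) * rightDegree G φ x =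
        ((φ x : ℕ) + 1) * rightDegree G φ x := by
    intro x hx
    simp only [mem_erase] at hx
    rw [Equiv.trans_apply, Equiv.swap_apply_of_ne_of_ne hx.2.1 hx.1]
  rw [sum_congr rfl h3] at h2
  simp only [Equiv.trans_apply, Equiv.swap_apply_left, Equiv.swap_apply_right] at h2
  have h4 : (φ u : ℕ) < φ w := huw
  by_contra! hlt
  nlinarith

/-- The rearrangement inequality for orderings. -/
theorem sum_location_mul_le {φ ψ : V ≃ Fin n} {f : V → ℕ}
    (h : ∀ u w, φ u < φ w → f w ≤ f u) :
    ∑ v, ((φ v : ℕ) + 1) * f v ≤ ∑ v, ((ψ v : ℕ) + 1) * f v := by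
  have h1 : Antivary (fun i : Fin n => f (φ.symm i)) (fun i : Fin n => (i : ℕ) + 1) := by
    intro i j hij
    exact h _ _ (by simpa using hij)
  have h2 := h1.sum_mul_le_sum_mul_comp_perm (σ := φ.symm.trans ψ)
  rw [← Equiv.sum_comp φ, ← Equiv.sum_comp φ] at h2
  simpa [mul_comm] using h2

/-- An ordering whose right degrees with respect to an optimal ordering are sorted is optimal. -/
theorem IsOptimal.of_sorted {G : SimpleGraph V} {φ ψ : V ≃ Fin n} (h : IsOptimal G φ)
    (hs : ∀ u w, ψ u < ψ w → rightDegree G φ w ≤ rightDegree G φ u) : IsOptimal G ψ := by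
  intro χ
  refine le_trans ?_ (h χ)
  rw [cost_eq_sum G φ]
  exact (cost_le_sum G φ ψ).trans (sum_location_mul_le hs)

theorem Twins.cost_swap {G : SimpleGraph V} {u w : V} (h : Twins G u w) (φ : V ≃ Fin n) :
    cost G ((Equiv.swap u w).trans φ) = cost G φ := by
  suffices 2 * cost G ((Equiv.swap u w).trans φ) = 2 * cost G φ by omega
  rw [two_mul_cost, two_mul_cost, ← Equiv.sum_comp (Equiv.swap u w)]
  refine sum_congr rfl fun x _ => ?_
  rw [← Equiv.sum_comp (Equiv.swap u w)]
  refine sum_congr rfl fun y _ => ?_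
  simp [h.adj_swap]

/-- In an optimal ordering no common neighbour of two twins lies between them. -/
theorem IsOptimal.not_adj_between {G : SimpleGraph V} {φ : V ≃ Fin n} (h : IsOptimal G φ)
    {u w x : V} (ht : Twins G u w) (hux : φ u < φ x) (hxw : φ x < φ w) : ¬ G.Adj u x := by
  intro hadj
  have hp : (φ u : ℕ) < φ x := hux
  have hq : (φ x : ℕ) < φ w := hxw
  have hwn := (φ w).2
  -- `A` moves `w` to just after `u`, shifting the vertices between them up by one; `B` moves `u` to
  -- just before `w`, shifting them down by one. On average the vertices between do not move.
  obtain ⟨A, hA⟩ := exists_ordering_of_injective φ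
    (fun i => if i = φ w then φ u + 1 else if φ u < i ∧ i < φ w then i + 1 else i)
    (fun i hi => by split_ifs <;> omega)
    (fun i j hij => by split_ifs at hij <;> omega)
  obtain ⟨B, hB⟩ := exists_ordering_of_injective φ
    (fun i => if i = φ u then φ w - 1 else if φ u < i ∧ i < φ w then i - 1 else i)
    (fun i hi => by split_ifs <;> omega)
    (fun i j hij => by split_ifs at hij <;> omega)
  have huw : u ≠ w := fun e => by subst e; omega
  have hnadj : ¬ G.Adj u w := fun e => G.irrefl ((ht w).1 e)
  have hAu : (A u : ℕ) = φ u := by rw [hA]; split_ifs <;> omega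
  have hAw : (A w : ℕ) = φ u + 1 := by rw [hA]; simp
  have hBu : (B u : ℕ) = φ w - 1 := by rw [hB]; simp
  have hBw : (B w : ℕ) = φ w := by rw [hB]; split_ifs <;> omega
  have hoth : ∀ v, v ≠ u → v ≠ w → (φ v : ℕ) ≠ φ u ∧ (φ v : ℕ) ≠ φ w := fun v h1 h2 =>
    ⟨fun e => h1 (φ.injective (Fin.ext e)), fun e => h2 (φ.injective (Fin.ext e))⟩
  have hoA : ∀ v, v ≠ u → v ≠ w →
      (A v : ℕ) = if (φ u : ℕ) < φ v ∧ (φ v : ℕ) < φ w then (φ v : ℕ) + 1 else φ v := by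
    intro v h1 h2
    rw [hA, if_neg (hoth v h1 h2).2]
  have hoB : ∀ v, v ≠ u → v ≠ w →
      (B v : ℕ) = if (φ u : ℕ) < φ v ∧ (φ v : ℕ) < φ w then (φ v : ℕ) - 1 else φ v := by
    intro v h1 h2
    rw [hB, if_neg (hoth v h1 h2).1]
  set τ := Equiv.swap u w with hτ
  have hτu : τ u = w := Equiv.swap_apply_left u w
  have hτw : τ w = u := Equiv.swap_apply_right u w
  have hτo : ∀ v, v ≠ u → v ≠ w → τ v = v := fun v h1 h2 => Equiv.swap_apply_of_ne_of_ne h1 h2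
  -- Adding the images under the swap treats the edges from `y` to `u` and to `w` together. For `y`
  -- at location `i` between `u` at `p` and `w` at `q`, the new weights sum to `p + (p + 1) + 2 * (i
  -- - 1)`, one less than `2 * (p + i)`. No other pair gets worse on average.
  have key : ∀ v y, G.Adj v y →
      min (A v : ℕ) (A y) + min (B v : ℕ) (B y) + min (A (τ v) : ℕ) (A (τ y)) +
        min (B (τ v) : ℕ) (B (τ y)) + (if v = u ∧ y = x then 1 else 0) ≤
      2 * min (φ v : ℕ) (φ y) + 2 * min (φ (τ v) : ℕ) (φ (τ y)) := by
    intro v y hvy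
    by_cases hv1 : v = u
    · subst hv1
      have hy1 : y ≠ v := hvy.ne'
      have hy2 : y ≠ w := fun e => hnadj (e ▸ hvy)
      rw [hτu, hτo y hy1 hy2, hAu, hAw, hBu, hBw, hoA y hy1 hy2, hoB y hy1 hy2]
      have := hoth y hy1 hy2
      by_cases hyx : y = x
      · subst hyx
        rw [if_pos ⟨hp, hq⟩, if_pos ⟨hp, hq⟩, if_pos ⟨rfl, rfl⟩]
        omega
      · rw [if_neg (fun e : v = v ∧ y = x => hyx e.2)]
        split_ifs <;> omega
    · rw [if_neg (fun e : v = u ∧ y = x => hv1 e.1)]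
      by_cases hv2 : v = w
      · subst hv2
        have hy1 : y ≠ u := fun e => hnadj (e ▸ hvy.symm)
        have hy2 : y ≠ v := hvy.ne'
        rw [hτw, hτo y hy1 hy2, hAu, hAw, hBu, hBw, hoA y hy1 hy2, hoB y hy1 hy2]
        have := hoth y hy1 hy2
        split_ifs <;> omega
      · rw [hτo v hv1 hv2, hoA v hv1 hv2, hoB v hv1 hv2]
        have := hoth v hv1 hv2
        by_cases hy1 : y = u
        · subst hy1
          rw [hτu, hAu, hAw, hBu, hBw]
          split_ifs <;> omega
        · by_cases hy2 : y = w
          · subst hy2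
            rw [hτw, hAu, hAw, hBu, hBw]
            split_ifs <;> omega
          · rw [hτo y hy1 hy2, hoA y hy1 hy2, hoB y hy1 hy2]
            split_ifs <;> omega
  -- The swap preserves the cost of `φ`, so the right side is eight times the minimum cost, while
  -- the left side is at least that plus one.
  have hsum : 2 * cost G A + 2 * cost G B + 2 * cost G (τ.trans A) + 2 * cost G (τ.trans B) + 1 ≤
      2 * (2 * cost G φ) + 2 * (2 * cost G (τ.trans φ)) := by
    have h1 : (1 : ℕ) = ∑ v, ∑ y, if v = u ∧ y = x then 1 else 0 := by
      rw [sum_eq_single u, sum_eq_single x] <;> simp +contextual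
    rw [show ∀ a b : ℕ, a + 1 ≤ b ↔ a + (∑ v, ∑ y, if v = u ∧ y = x then 1 else 0) ≤ b from
      fun a b => by rw [← h1]]
    simp only [two_mul_cost, mul_sum, ← sum_add_distrib]
    refine sum_le_sum fun v _ => sum_le_sum fun y _ => ?_
    by_cases hvy : G.Adj v y
    · have := key v y hvy
      simp only [hvy, if_true, Equiv.trans_apply]
      omega
    · have : ¬ (v = u ∧ y = x) := by rintro ⟨rfl, rfl⟩; exact hvy hadj
      simp [hvy, this]
  have e1 := ht.cost_swap φ
  have l1 := h A
  have l2 := h B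
  have l3 := h (τ.trans A)
  have l4 := h (τ.trans B)
  rw [← hτ] at e1
  omega

/-- No common neighbour lies between the twins, and none is a twin itself, so each comes after both
or before both. -/
theorem IsOptimal.rightDegree_eq_of_twins {G : SimpleGraph V} {φ : V ≃ Fin n} (h : IsOptimal G φ)
    {u w : V} (ht : Twins G u w) : rightDegree G φ u = rightDegree G φ w := by
  wlog huw : φ u < φ w generalizing u w
  · rcases eq_or_lt_of_le (not_lt.1 huw) with e | e
    · rw [φ.injective e]
    · exact (this (fun x => (ht x).symm) e).symm
  rw [rightDegree, rightDegree]
  congr 1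
  ext y
  simp only [Set.mem_ofPred_eq, ← ht y]
  refine and_congr_right fun hy => ⟨fun hlt => ?_, fun hlt => huw.trans hlt⟩
  by_contra hle
  rcases eq_or_lt_of_le (not_lt.1 hle) with e | e
  · exact G.irrefl ((ht w).1 (φ.injective e ▸ hy))
  · exact h.not_adj_between ht hlt e hy

/-- Every injective key on `n` elements is realized by an ordering. -/
theorem exists_ordering_of_key {α : Type*} [LinearOrder α] (hn : Fintype.card V = n) (κ : V → α)
    (hκ : Function.Injective κ) : ∃ ψ : V ≃ Fin n, ∀ u w, ψ u < ψ w ↔ κ u < κ w := by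
  let : LinearOrder V := LinearOrder.lift' κ hκ
  let e := Fintype.orderIsoFinOfCardEq V hn
  exact ⟨e.symm.toEquiv, fun u w => e.symm.lt_iff_lt⟩

/-- Every partition of the vertices into classes of twins has an optimal ordering in which every
class is consecutive and sorted by a prescribed key. -/
theorem exists_optimal_consecutive {α β : Type*} [LinearOrder α] [LinearOrder β]
    (hn : Fintype.card V = n) (G : SimpleGraph V)
    (κ : V → α) (hκ : ∀ u w, κ u = κ w → Twins G u w) (ι : V → β) (hι : Function.Injective ι) :
    ∃ φ : V ≃ Fin n, IsOptimal G φ ∧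
      (∀ u x w, κ u = κ w → φ u < φ x → φ x < φ w → κ x = κ u) ∧
      ∀ u w, κ u = κ w → (φ u < φ w ↔ ι u < ι w) := by
  obtain ⟨φ₀, hφ₀⟩ : ∃ φ₀ : V ≃ Fin n, IsOptimal G φ₀ := by
    have : Nonempty (V ≃ Fin n) := ⟨Fintype.equivFinOfCardEq hn⟩
    exact Finite.exists_min (cost G)
  obtain ⟨ψ, hψ⟩ := exists_ordering_of_key hn
    -- Decreasing right degree comes first, for optimality. Since it is constant on each class, the
    -- second key keeps classes consecutive and the third orders their members.
    (fun v => toLex (OrderDual.toDual (rightDegree G φ₀ v), toLex (κ v, ι v)))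
    (fun u w h => by
      have h1 := congrArg ofLex h
      simp only [ofLex_toLex, Prod.mk.injEq] at h1
      have h2 := congrArg ofLex h1.2
      simp only [ofLex_toLex, Prod.mk.injEq] at h2
      exact hι h2.2)
  simp only [Prod.Lex.toLex_lt_toLex, OrderDual.toDual_lt_toDual,
    OrderDual.toDual_inj] at hψ
  refine ⟨ψ, hφ₀.of_sorted fun u w huw => ?_, fun u x w huw h1 h2 => ?_, fun u w huw => ?_⟩
  · rcases (hψ u w).1 huw with h | ⟨h, -⟩
    · exact h.le
    · exact h.ge
  · have he := hφ₀.rightDegree_eq_of_twins (hκ _ _ huw)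
    have h1 := (hψ u x).1 h1
    have h2 := (hψ x w).1 h2
    rw [huw] at h1 ⊢
    rcases h1 with h1 | ⟨e1, h1⟩ <;> rcases h2 with h2 | ⟨e2, h2⟩
    · omega
    · omega
    · omega
    · rcases h1 with h1 | ⟨h1, -⟩ <;> rcases h2 with h2 | ⟨h2, -⟩
      · exact absurd h1 h2.not_gt
      · exact h2
      · exact h1.symm
      · exact h2
  · have he := hφ₀.rightDegree_eq_of_twins (hκ _ _ huw)
    rw [hψ, huw, he]
    simp

end Orderings

end MSVC

namespace MSVC

/-! ### Configurations over a vertex cover. -/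

section Configurations

open Classical Finset

variable {V : Type*} {n : ℕ}

theorem blockIndex_mono (S : Finset V) (φ : V ≃ Fin n) {u w : V} (h : φ u ≤ φ w) :
    blockIndex S φ u ≤ blockIndex S φ w := by
  refine card_le_card fun v hv => ?_
  rw [mem_filter] at hv ⊢
  exact ⟨hv.1, hv.2.trans_le h⟩

theorem blockIndex_lt {S : Finset V} {φ : V ≃ Fin n} {u w : V} (hu : u ∈ S) (h : φ u < φ w) :
    blockIndex S φ u < blockIndex S φ w := by
  refine card_lt_card ⟨fun v hv => ?_, fun hsub => ?_⟩
  · rw [mem_filter] at hv ⊢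
    exact ⟨hv.1, hv.2.trans h⟩
  · have := hsub (mem_filter.2 ⟨hu, h⟩)
    simp at this

/-- An element of `S` is itself counted in the block index of everything after it, so block indices
alone decide comparisons with it. -/
theorem lt_iff_blockIndex_lt {S : Finset V} {φ : V ≃ Fin n} {u w : V} (hu : u ∈ S) :
    φ u < φ w ↔ blockIndex S φ u < blockIndex S φ w :=
  ⟨blockIndex_lt hu, fun h => lt_of_not_ge fun h' => h.not_ge (blockIndex_mono S φ h')⟩

theorem twins_of_nbhd_eq [Fintype V] {G : SimpleGraph V} {S : Finset V}
    (hS : G.IsVertexCover (S : Set V)) {u w : V} (hu : u ∉ S) (hw : w ∉ S)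
    (h : nbhd G S u = nbhd G S w) : Twins G u w := by
  intro x
  have key : ∀ hx : x ∈ S, G.Adj u x ↔ G.Adj w x := fun hx => by
    have := Set.ext_iff.1 h ⟨x, hx⟩
    simpa [nbhd] using this
  constructor
  · intro hux
    have hx : x ∈ S := (hS hux).resolve_left (by simpa using hu)
    exact (key hx).1 hux
  · intro hwx
    have hx : x ∈ S := (hS hwx).resolve_left (by simpa using hw)
    exact (key hx).2 hwx

/-- Two realizations of a configuration have the same block indices. -/
theorem Realizes.blockIndex_eq {G : SimpleGraph V} {S : Finset V} {σ : S ≃ Fin S.card}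
    {b : Set S → Fin (S.card + 1)} {φ ψ : V ≃ Fin n} (hφ : Realizes G S σ b φ)
    (hψ : Realizes G S σ b ψ) (u : V) : blockIndex S φ u = blockIndex S ψ u := by
  by_cases hu : u ∈ S
  · rw [blockIndex, blockIndex]
    congr 1
    refine filter_congr fun v hv => ?_
    exact (hφ.order ⟨v, hv⟩ ⟨u, hu⟩).trans (hψ.order ⟨v, hv⟩ ⟨u, hu⟩).symm
  · rw [hφ.block u hu, hψ.block u hu]

/-- Two realizations of a configuration differ only inside of the blocks. -/
theorem Realizes.lt_iff {G : SimpleGraph V} {S : Finset V} {σ : S ≃ Fin S.card}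
    {b : Set S → Fin (S.card + 1)} {φ ψ : V ≃ Fin n} (hφ : Realizes G S σ b φ)
    (hψ : Realizes G S σ b ψ) {u w : V}
    (h : u ∈ S ∨ w ∈ S ∨ blockIndex S φ u ≠ blockIndex S φ w) : φ u < φ w ↔ ψ u < ψ w := by
  have e := hφ.blockIndex_eq hψ
  have aux : ∀ {x y : V}, x ∈ S → (φ x < φ y ↔ ψ x < ψ y) := fun {x y} hx => by
    rw [lt_iff_blockIndex_lt hx, lt_iff_blockIndex_lt hx, e, e]
  rcases h with h | h | h
  · exact aux h
  · rcases eq_or_ne u w with rfl | hne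
    · simp
    have h1 : φ u ≠ φ w := fun e => hne (φ.injective e)
    have h2 : ψ u ≠ ψ w := fun e => hne (ψ.injective e)
    rw [← not_iff_not, not_lt, not_lt, h1.symm.le_iff_lt, h2.symm.le_iff_lt]
    exact aux h
  · have h' : blockIndex S ψ u ≠ blockIndex S ψ w := by rwa [← e, ← e]
    have aux' : ∀ χ : V ≃ Fin n, blockIndex S χ u ≠ blockIndex S χ w →
        (χ u < χ w ↔ blockIndex S χ u < blockIndex S χ w) := fun χ hχ =>
      ⟨fun hlt => lt_of_le_of_ne (blockIndex_mono S χ hlt.le) hχ,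
        fun hlt => lt_of_not_ge fun h' => hlt.not_ge (blockIndex_mono S χ h')⟩
    rw [aux' φ h, aux' ψ h', e, e]

/-- Right degrees only compare adjacent vertices, one of which lies in the cover; the configuration
fixes such comparisons. -/
theorem Realizes.rightDegree_eq [Fintype V] {G : SimpleGraph V} {S : Finset V}
    (hS : G.IsVertexCover (S : Set V)) {σ : S ≃ Fin S.card}
    {b : Set S → Fin (S.card + 1)} {φ ψ : V ≃ Fin n} (hφ : Realizes G S σ b φ)
    (hψ : Realizes G S σ b ψ) (u : V) : rightDegree G φ u = rightDegree G ψ u := by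
  rw [rightDegree, rightDegree]
  congr 1
  ext y
  refine and_congr_right fun hy => hφ.lt_iff hψ ?_
  rcases hS hy with h | h
  · exact Or.inl h
  · exact Or.inr (Or.inl h)

/-- If one realization of a configuration is optimal, then so are all others. -/
theorem Realizes.isOptimal [Fintype V] {G : SimpleGraph V} {S : Finset V}
    (hS : G.IsVertexCover (S : Set V)) {σ : S ≃ Fin S.card}
    {b : Set S → Fin (S.card + 1)} {φ ψ : V ≃ Fin n} (hψ : Realizes G S σ b ψ)
    (ho : IsOptimal G ψ) (hφ : Realizes G S σ b φ) : IsOptimal G φ := by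
  refine ho.of_sorted fun u w huw => ?_
  by_cases h : u ∈ S ∨ w ∈ S ∨ blockIndex S φ u ≠ blockIndex S φ w
  -- Here `ψ` orders the pair in the same way, and its right degrees are monotone by optimality.
  -- Pairs inside one block are handled by the sortedness of `φ` itself.
  · exact ho.rightDegree_le ((hφ.lt_iff hψ h).1 huw)
  · push Not at h
    rw [← hφ.rightDegree_eq hS hψ, ← hφ.rightDegree_eq hS hψ]
    exact hφ.sorted u w h.1 h.2.1 h.2.2 huw

/-- For every vertex cover there is a configuration that is realized by an optimal ordering. -/
theorem exists_realizes_optimal [Fintype V] (hn : Fintype.card V = n) (G : SimpleGraph V)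
    (S : Finset V) (hS : G.IsVertexCover (S : Set V)) :
    ∃ (σ : S ≃ Fin S.card) (b : Set S → Fin (S.card + 1)) (φ : V ≃ Fin n),
      Realizes G S σ b φ ∧ IsOptimal G φ := by
  -- Each element of `S` forms a class of its own, so that equally coloured vertices are twins and
  -- no element of `S` can interrupt a class.
  let c : V → Set S ⊕ S := fun u => if h : u ∈ S then Sum.inr ⟨u, h⟩ else Sum.inl (nbhd G S u)
  have c_in : ∀ {u} (h : u ∈ S), c u = Sum.inr ⟨u, h⟩ := fun h => dif_pos h
  have c_out : ∀ {u} (_ : u ∉ S), c u = Sum.inl (nbhd G S u) := fun h => dif_neg h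
  let e := Finite.equivFin (Set S ⊕ S)
  obtain ⟨φ, ho, hc, -⟩ := exists_optimal_consecutive hn G (fun u => e (c u))
    (fun u w h => by
      have h := e.injective h
      by_cases hu : u ∈ S <;> by_cases hw : w ∈ S
      · rw [c_in hu, c_in hw] at h
        cases (Sum.inr_injective h)
        exact fun _ => Iff.rfl
      · rw [c_in hu, c_out hw] at h; cases h
      · rw [c_out hu, c_in hw] at h; cases h
      · rw [c_out hu, c_out hw] at h
        exact twins_of_nbhd_eq hS hu hw (Sum.inl_injective h))
    (Fintype.equivFin V) (Fintype.equivFin V).injective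
  have hcons : ∀ u w, u ∉ S → w ∉ S → nbhd G S u = nbhd G S w →
      ∀ x, φ u < φ x → φ x < φ w → x ∉ S ∧ nbhd G S x = nbhd G S u := by
    intro u w hu hw huw x h1 h2
    have h3 := e.injective (hc u x w (by rw [c_out hu, c_out hw, huw]) h1 h2)
    rw [c_out hu] at h3
    have hx : x ∉ S := fun hx => by rw [c_in hx] at h3; cases h3
    rw [c_out hx] at h3
    exact ⟨hx, Sum.inl_injective h3⟩
  have hsame : ∀ u w, u ∉ S → w ∉ S → nbhd G S u = nbhd G S w →
      blockIndex S φ u = blockIndex S φ w := by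
    intro u w hu hw huw
    wlog hlt : φ u < φ w generalizing u w
    · rcases eq_or_lt_of_le (not_lt.1 hlt) with h | h
      · rw [φ.injective h]
      · exact (this w u hw hu huw.symm h).symm
    rw [blockIndex, blockIndex]
    congr 1
    refine filter_congr fun x hx => ⟨fun h => h.trans hlt, fun h => ?_⟩
    by_contra hle
    rcases eq_or_lt_of_le (not_lt.1 hle) with h' | h'
    · exact hu (φ.injective h' ▸ hx)
    · exact (hcons u w hu hw huw x h' h).1 hx
  have hlt : ∀ s : S, blockIndex S φ s < S.card := fun s =>
    card_lt_card ⟨filter_subset _ _, fun h => by have := h s.2; simp at this⟩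
  have hinj : Function.Injective fun s : S => (⟨blockIndex S φ s, hlt s⟩ : Fin S.card) := by
    intro s t hst
    have hst : blockIndex S φ s = blockIndex S φ t := Fin.ext_iff.1 hst
    rcases lt_trichotomy (φ s) (φ t) with h | h | h
    · exact absurd hst (blockIndex_lt s.2 h).ne
    · exact Subtype.ext (φ.injective h)
    · exact absurd hst (blockIndex_lt t.2 h).ne'
  have hbij := (Fintype.bijective_iff_injective_and_card _).2 ⟨hinj, by simp⟩
  -- The order of `S` and the blocks are read off from `φ`. Subsets of `S` that are no vertex's
  -- neighbourhood get the irrelevant block `0`.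
  refine ⟨Equiv.ofBijective _ hbij,
    fun N => if h : ∃ u, u ∉ S ∧ nbhd G S u = N then
      ⟨blockIndex S φ h.choose, Nat.lt_succ_of_le (card_le_card (filter_subset _ _))⟩ else 0,
    φ, ⟨fun u v => ?_, fun u hu => ?_, hcons, fun u w _ _ _ h => ho.rightDegree_le h⟩, ho⟩
  · rw [lt_iff_blockIndex_lt u.2]
    exact Iff.rfl
  · have h : ∃ w, w ∉ S ∧ nbhd G S w = nbhd G S u := ⟨u, hu, rfl⟩
    rw [dif_pos h]
    exact hsame _ _ hu h.choose_spec.1 h.choose_spec.2.symm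

end Configurations

end MSVC

namespace MSVC

/-! ### The dynamic programme over twin closed sets. -/

section DynamicProgramming

open Classical Finset

variable {n : ℕ}

/-- The sum of the weights of all ordered adjacent pairs, for locations that need not come from an
ordering. -/
noncomputable def pairCost (G : SimpleGraph (Fin n)) (π : Fin n → ℕ) : ℕ :=
  ∑ u, ∑ v, if G.Adj u v then min (π u) (π v) else 0

/-- The vertices of `X`, arranged by `π` and then by their names; the other vertices are put to
the location `n`. -/
noncomputable def arrange (X : Finset (Fin n)) (π : Fin n → ℕ) (u : Fin n) : ℕ :=
  if u ∈ X then #{w ∈ X | π w < π u ∨ π w = π u ∧ w < u} else n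

/-- An ordering of the vertices of `X`, all other vertices being at the location `n`. -/
structure IsPartialOrdering (X : Finset (Fin n)) (π : Fin n → ℕ) : Prop where
  off : ∀ u ∉ X, π u = n
  on : ∀ u ∈ X, π u = #{w ∈ X | π w < π u}
  inj : ∀ u ∈ X, ∀ w ∈ X, π u = π w → u = w

theorem IsPartialOrdering.lt_card {X : Finset (Fin n)} {π : Fin n → ℕ}
    (h : IsPartialOrdering X π) {u : Fin n} (hu : u ∈ X) : π u < #X := by
  rw [h.on u hu]
  exact card_lt_card ⟨filter_subset _ _, fun hs => by have := hs hu; simp at this⟩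

theorem IsPartialOrdering.le {X : Finset (Fin n)} {π : Fin n → ℕ}
    (h : IsPartialOrdering X π) (u : Fin n) : π u ≤ n := by
  by_cases hu : u ∈ X
  · have := card_le_univ X
    rw [Fintype.card_fin] at this
    exact (h.lt_card hu).le.trans this
  · exact (h.off u hu).le

theorem arrange_lt_arrange {X : Finset (Fin n)} {π : Fin n → ℕ} {u w : Fin n} (hu : u ∈ X)
    (hw : w ∈ X) (h : π w < π u ∨ π w = π u ∧ w < u) : arrange X π w < arrange X π u := by
  rw [arrange, arrange, if_pos hu, if_pos hw]
  refine card_lt_card ⟨fun x hx => ?_, fun hs => ?_⟩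
  · rw [mem_filter] at hx ⊢
    refine ⟨hx.1, ?_⟩
    rcases hx.2 with h1 | ⟨h1, h1'⟩ <;> rcases h with h2 | ⟨h2, h2'⟩
    · exact Or.inl (h1.trans h2)
    · exact Or.inl (by omega)
    · exact Or.inl (by omega)
    · exact Or.inr ⟨h1.trans h2, h1'.trans h2'⟩
  · have := hs (mem_filter.2 ⟨hw, h⟩)
    simp at this

theorem arrange_lt_iff {X : Finset (Fin n)} {π : Fin n → ℕ} {u w : Fin n} (hu : u ∈ X)
    (hw : w ∈ X) : arrange X π w < arrange X π u ↔ π w < π u ∨ π w = π u ∧ w < u := by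
  refine ⟨fun h => ?_, arrange_lt_arrange hu hw⟩
  by_contra hcon
  rcases eq_or_ne u w with rfl | hne
  · exact h.false
  · have : π u < π w ∨ π u = π w ∧ u < w := by
      by_contra h'
      apply hne
      omega
    exact h.not_gt (arrange_lt_arrange hw hu this)

theorem isPartialOrdering_arrange (X : Finset (Fin n)) (π : Fin n → ℕ) :
    IsPartialOrdering X (arrange X π) := by
  refine ⟨fun u hu => if_neg hu, fun u hu => ?_, fun u hu w hw h => ?_⟩
  · nth_rewrite 1 [arrange]
    rw [if_pos hu]
    congr 1
    refine filter_congr fun w hw => (arrange_lt_iff hu hw).symm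
  · have h1 := mt (arrange_lt_iff (π := π) hu hw).2 h.not_gt
    have h2 := mt (arrange_lt_iff (π := π) hw hu).2 h.symm.not_gt
    omega

theorem twins_iff_neighborSet_eq {G : SimpleGraph (Fin n)} {u w : Fin n} :
    Twins G u w ↔ G.neighborSet u = G.neighborSet w := by
  rw [Set.ext_iff]; rfl

/-- A set that contains with every vertex all of its twins. -/
def TwinClosed (G : SimpleGraph (Fin n)) (X : Finset (Fin n)) : Prop :=
  ∀ u w, Twins G u w → u ∈ X → w ∈ X

/-- `X 0, …, X (N - 1)` lists all twin closed subsets of its last member, which contains the first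
`m` vertices; subsets come before supersets. -/
structure ListsTwinClosed (G : SimpleGraph (Fin n)) (m N : ℕ) (X : ℕ → Finset (Fin n)) : Prop where
  pos : 0 < N
  closed : ∀ i < N, TwinClosed G (X i)
  full : ∀ u : Fin n, (u : ℕ) < m → u ∈ X (N - 1)
  subset_last : ∀ i < N, X i ⊆ X (N - 1)
  surj : ∀ Y, TwinClosed G Y → Y ⊆ X (N - 1) → ∃ i < N, X i = Y
  mono : ∀ i < N, ∀ j < N, X i ⊆ X j → i ≤ j

theorem listsTwinClosed_one (G : SimpleGraph (Fin n)) {X : ℕ → Finset (Fin n)} (h : X 0 = ∅) :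
    ListsTwinClosed G 0 1 X where
  pos := one_pos
  closed i hi := by
    obtain rfl : i = 0 := by omega
    intro u w _ hu
    simp [h] at hu
  full u hu := absurd hu (Nat.not_lt_zero _)
  subset_last i hi := by
    obtain rfl : i = 0 := by omega
    exact Subset.rfl
  surj Y _ hY := ⟨0, one_pos, by rw [h]; exact (subset_empty.1 (h ▸ hY)).symm⟩
  mono i hi j hj _ := by omega

theorem ListsTwinClosed.skip {G : SimpleGraph (Fin n)} {m N : ℕ} {X : ℕ → Finset (Fin n)}
    (h : ListsTwinClosed G m N X) (hm : ∀ u : Fin n, (u : ℕ) = m → u ∈ X (N - 1)) :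
    ListsTwinClosed G (m + 1) N X :=
  { h with full := fun u hu => (Nat.lt_succ_iff_lt_or_eq.1 hu).elim (h.full u) (hm u) }

/-- A twin closed set either avoids the class of `v` or contains all of it, so a second copy of the
list with that class adjoined completes it. No old set meets the class, hence no new set is
contained in an old one. -/
theorem ListsTwinClosed.double {G : SimpleGraph (Fin n)} {N : ℕ} {X Y : ℕ → Finset (Fin n)}
    {v : Fin n} (h : ListsTwinClosed G v N X) (hv : v ∉ X (N - 1))
    (hY₁ : ∀ i < N, Y i = X i) (hY₂ : ∀ i < N, ∀ u, u ∈ Y (N + i) ↔ Twins G u v ∨ u ∈ X i) :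
    ListsTwinClosed G (v + 1) (N + N) Y := by
  have hN := h.pos
  have hlast : ∀ u, u ∈ Y (N + N - 1) ↔ Twins G u v ∨ u ∈ X (N - 1) := by
    intro u
    rw [← hY₂ (N - 1) (by omega), show N + N - 1 = N + (N - 1) by omega]
  have hcases : ∀ i < N + N, i < N ∨ ∃ j < N, i = N + j := fun i hi => by
    rcases lt_or_ge i N with h | h
    · exact Or.inl h
    · exact Or.inr ⟨i - N, by omega, by omega⟩
  have hdisj : ∀ i < N, ∀ u, Twins G u v → u ∉ X i := fun i hi u hu hui =>
    hv (h.closed _ (by omega) _ _ hu (h.subset_last i hi hui))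
  have hvv : Twins G v v := fun _ => Iff.rfl
  refine ⟨by omega, fun i hi => ?_, fun u hu => ?_, fun i hi u hu => ?_, fun Z hZ hZs => ?_,
    fun i hi j hj hij => ?_⟩
  · rcases hcases i hi with hi | ⟨j, hj, rfl⟩
    · rw [hY₁ i hi]; exact h.closed i hi
    · intro u w huw hu
      rw [hY₂ j hj] at hu ⊢
      rcases hu with hu | hu
      · exact Or.inl fun x => (huw x).symm.trans (hu x)
      · exact Or.inr (h.closed j hj _ _ huw hu)
  · rw [hlast]
    rcases Nat.lt_succ_iff_lt_or_eq.1 hu with hu | hu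
    · exact Or.inr (h.full u hu)
    · rw [Fin.ext hu]; exact Or.inl hvv
  · rw [hlast]
    rcases hcases i hi with hi | ⟨j, hj, rfl⟩
    · rw [hY₁ i hi] at hu; exact Or.inr (h.subset_last i hi hu)
    · rw [hY₂ j hj] at hu; exact hu.imp_right fun hu => h.subset_last j hj hu
  · obtain ⟨i, hi, hXi⟩ := h.surj {u ∈ Z | ¬ Twins G u v}
      (fun u w huw hu => by
        rw [mem_filter] at hu ⊢
        exact ⟨hZ _ _ huw hu.1, fun hw => hu.2 fun x => (huw x).trans (hw x)⟩)
      (fun u hu => by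
        rw [mem_filter] at hu
        exact ((hlast u).1 (hZs hu.1)).resolve_left hu.2)
    by_cases hvZ : v ∈ Z
    · refine ⟨N + i, by omega, ?_⟩
      ext u
      rw [hY₂ i hi, hXi, mem_filter]
      constructor
      · rintro (hu | hu)
        · exact hZ _ _ (fun x => (hu x).symm) hvZ
        · exact hu.1
      · intro hu
        by_cases ht : Twins G u v
        · exact Or.inl ht
        · exact Or.inr ⟨hu, ht⟩
    · refine ⟨i, by omega, ?_⟩
      rw [hY₁ i hi, hXi, filter_eq_self]
      exact fun u hu ht => hvZ (hZ _ _ ht hu)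
  · rcases hcases i hi with hi | ⟨i, hi', rfl⟩ <;> rcases hcases j hj with hj | ⟨j, hj', rfl⟩
    · rw [hY₁ i hi, hY₁ j hj] at hij
      exact h.mono i hi j hj hij
    · omega
    · rw [hY₁ j hj] at hij
      exact absurd (hij ((hY₂ i hi' v).2 (Or.inl hvv))) (hdisj j hj v hvv)
    · refine Nat.add_le_add_left (h.mono i hi' j hj' fun u hu => ?_) N
      exact ((hY₂ j hj' u).1 (hij ((hY₂ i hi' u).2 (Or.inr hu)))).resolve_left
        fun ht => hdisj i hi' u ht hu

/-- There are at most `2 ^ (k + 2 ^ k)` twin closed sets if there is a vertex cover of size `k`. -/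
theorem ListsTwinClosed.le_two_pow {G : SimpleGraph (Fin n)} {m N k : ℕ}
    {X : ℕ → Finset (Fin n)} (h : ListsTwinClosed G m N X) {S : Finset (Fin n)}
    (hS : G.IsVertexCover (S : Set (Fin n))) (hk : #S = k) : N ≤ 2 ^ (k + 2 ^ k) := by
  -- Twin classes correspond to neighbourhoods: at most `k` come from `S`, and the neighbourhood of
  -- any other vertex is a subset of `S`. A twin closed set is determined by the neighbourhoods of
  -- its members.
  let Q : Finset (Finset (Fin n)) := univ.image fun u => G.neighborFinset u
  have hQ : #Q ≤ k + 2 ^ k := by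
    have h1 : Q ⊆ S.image (fun u => G.neighborFinset u) ∪ S.powerset := by
      intro A hA
      obtain ⟨u, -, rfl⟩ := mem_image.1 hA
      by_cases hu : u ∈ S
      · exact mem_union_left _ (mem_image_of_mem _ hu)
      · refine mem_union_right _ (mem_powerset.2 fun x hx => ?_)
        rw [SimpleGraph.mem_neighborFinset] at hx
        exact (hS hx).resolve_left (by simpa using hu)
    calc #Q ≤ _ := card_le_card h1
      _ ≤ _ := card_union_le _ _
      _ ≤ k + 2 ^ k := by
        rw [card_powerset, hk]
        exact Nat.add_le_add_right (hk ▸ card_image_le) _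
  have h2 : #(range N) ≤ #Q.powerset := by
    refine card_le_card_of_injOn (fun i => (X i).image fun u => G.neighborFinset u)
      (fun i _ => ?_) (fun i hi j hj hij => ?_)
    · rw [coe_powerset, Set.mem_preimage, Set.mem_powerset_iff, coe_subset]
      exact image_subset_image (subset_univ _)
    · have hi : i < N := by simpa using hi
      have hj : j < N := by simpa using hj
      have aux : ∀ i < N, ∀ j < N, ((X i).image fun u => G.neighborFinset u) =
          ((X j).image fun u => G.neighborFinset u) → X i ⊆ X j := by
        intro i _ j hj hij u hu
        have := mem_image_of_mem (fun u => G.neighborFinset u) hu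
        rw [hij, mem_image] at this
        obtain ⟨w, hw, hwu⟩ := this
        refine h.closed j hj w u (fun x => ?_) hw
        have := Finset.ext_iff.1 hwu x
        simpa using this
      exact le_antisymm (h.mono i hi j hj (aux i hi j hj hij))
        (h.mono j hj i hi (aux j hj i hi hij.symm))
  rw [card_range, card_powerset] at h2
  exact h2.trans (Nat.pow_le_pow_right two_pos hQ)

/-- Counting locations from `0` changes the doubled cost by a constant independent of `φ`, so
comparing `pairCost` suffices. -/
theorem two_mul_cost_eq_pairCost (G : SimpleGraph (Fin n)) (φ : Fin n ≃ Fin n) :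
    2 * cost G φ = pairCost G (fun v => φ v) + ∑ u, ∑ v, if G.Adj u v then 1 else 0 := by
  rw [two_mul_cost, pairCost, ← sum_add_distrib]
  refine sum_congr rfl fun u _ => ?_
  rw [← sum_add_distrib]
  refine sum_congr rfl fun v _ => ?_
  split_ifs <;> rfl

theorem card_filter_lt (φ : Fin n ≃ Fin n) (u : Fin n) : #{w | φ w < φ u} = φ u := by
  rw [← Fin.card_Iio (φ u)]
  exact card_equiv φ (by simp)

/-- The dynamic programme over the twin closed sets finds an optimal ordering. -/
theorem ListsTwinClosed.exists_optimal {G : SimpleGraph (Fin n)} {N : ℕ}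
    {X : ℕ → Finset (Fin n)} (h : ListsTwinClosed G n N X) {π : ℕ → Fin n → ℕ}
    (hπ : ∀ i < N, IsPartialOrdering (X i) (π i))
    (hmin : ∀ i < N, ∀ j < i, pairCost G (π i) ≤ pairCost G (arrange (X i) (π j))) :
    ∃ φ : Fin n ≃ Fin n, (∀ v, π (N - 1) v = φ v) ∧ IsOptimal G φ := by
  have hN := h.pos
  let e := Finite.equivFin (Set (Fin n))
  -- The members of a class are ordered by name because `arrange` breaks ties by name.
  obtain ⟨φ, ho, hc, hs⟩ := exists_optimal_consecutive (Fintype.card_fin n) G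
    (fun u => e (G.neighborSet u))
    (fun u w huw => twins_iff_neighborSet_eq.2 (e.injective huw)) (id : Fin n → Fin n)
    Function.injective_id
  have htw : ∀ u w, Twins G u w → e (G.neighborSet u) = e (G.neighborSet w) := fun u w huw =>
    congrArg e (twins_iff_neighborSet_eq.1 huw)
  -- Whenever a listed set is an initial segment of `φ`, its computed ordering is at least as good
  -- as that segment. The case of the whole vertex set is the claim.
  have main : ∀ i < N, ∀ c ≤ n, (∀ v, v ∈ X i ↔ (φ v : ℕ) < c) →
      pairCost G (π i) ≤ pairCost G (fun v => if (φ v : ℕ) < c then φ v else n) := by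
    intro i
    induction i using Nat.strong_induction_on with
    | _ i ih =>
    intro hi c hcn hXi
    rcases Nat.eq_zero_or_pos c with rfl | hcpos
    · refine le_of_eq (congrArg _ (funext fun v => ?_))
      rw [(hπ i hi).off v (fun hv => by simpa using (hXi v).1 hv)]
      simp
    obtain ⟨z, hz⟩ : ∃ z, (φ z : ℕ) = c - 1 := ⟨φ.symm ⟨c - 1, by omega⟩, by simp⟩
    have hzX : z ∈ X i := (hXi z).2 (by omega)
    have hzz : Twins G z z := fun _ => Iff.rfl
    -- `z` is the last vertex of the segment and `d` its first twin. As the class is consecutive,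
    -- removing it leaves the segment before `d`, which is listed earlier.
    obtain ⟨d, hd, hdmin⟩ := exists_min_image ({v | Twins G z v} : Finset (Fin n)) φ
      ⟨z, by simpa using hzz⟩
    simp only [mem_filter, mem_univ, true_and] at hd hdmin
    have hdz := hdmin z hzz
    obtain ⟨j, hj, hXj⟩ := h.surj {v ∈ X i | ¬ Twins G z v}
      (fun u w huw hu => by
        rw [mem_filter] at hu ⊢
        exact ⟨h.closed i hi _ _ huw hu.1, fun hw => hu.2 fun x => (hw x).trans (huw x).symm⟩)
      ((filter_subset _ _).trans (h.subset_last i hi))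
    have hXj' : ∀ v, v ∈ X j ↔ v ∈ X i ∧ ¬ Twins G z v := fun v => by rw [hXj, mem_filter]
    have hji : j < i := by
      refine lt_of_le_of_ne (h.mono j hj i hi (hXj ▸ filter_subset _ _)) ?_
      rintro rfl
      exact ((hXj' z).1 hzX).2 hzz
    have hXjd : ∀ v, v ∈ X j ↔ (φ v : ℕ) < φ d := by
      intro v
      rw [hXj']
      constructor
      · rintro ⟨h1, h2⟩
        by_contra hle
        have h3 : φ v ≠ φ d := fun e => h2 (φ.injective e ▸ hd)
        have h4 : φ v ≠ φ z := fun e => h2 (φ.injective e ▸ hzz)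
        have h5 := (hXi v).1 h1
        have := hc d v z (htw _ _ fun x => (hd x).symm)
          (lt_of_le_of_ne (not_lt.1 hle) h3.symm) (lt_of_le_of_ne (by omega) h4)
        have := twins_iff_neighborSet_eq.2 (e.injective this)
        exact h2 fun x => (hd x).trans (this x).symm
      · intro hlt
        have h5 : (φ d : ℕ) ≤ φ z := hdz
        exact ⟨(hXi v).2 (by omega), fun hv => absurd (hdmin v hv) (not_le.2 hlt)⟩
    have hIH := ih j hji hj (φ d) (φ d).2.le hXjd
    have hm := hmin i hi j hji
    have hcard : #(X j) ≤ φ d := by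
      have := card_filter_lt φ d
      rw [← this]
      exact card_le_card fun v hv => by
        have := (hXjd v).1 hv
        simpa using this
    have hpj := hπ j hj
    have hdn := (φ d).2
    -- The cases are: `u` in the smaller set, in the appended class, or outside of the larger set.
    -- The class sits at location `n` under `π j`, so `arrange` puts it last, by name, exactly where
    -- `φ` has it.
    have tri : ∀ u,
        (arrange (X i) (π j) u = π j u ∧ π j u < φ d ∧ (φ u : ℕ) < φ d ∧ (φ u : ℕ) < c) ∨
        (arrange (X i) (π j) u = φ u ∧ π j u = n ∧ (φ d : ℕ) ≤ φ u ∧ (φ u : ℕ) < c) ∨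
        (arrange (X i) (π j) u = n ∧ π j u = n ∧ (φ d : ℕ) ≤ φ u ∧ c ≤ φ u) := by
      intro u
      by_cases hu : u ∈ X i
      · have huc := (hXi u).1 hu
        by_cases hu' : u ∈ X j
        · left
          have hlt := (hpj.lt_card hu').trans_le hcard
          refine ⟨?_, hlt, (hXjd u).1 hu', huc⟩
          rw [arrange, if_pos hu]
          refine Eq.trans (congrArg card ?_) (hpj.on u hu').symm
          ext w
          simp only [mem_filter]
          by_cases hw : w ∈ X j
          · have := (hXj' w).1 hw
            simp only [this.1, hw, true_and]
            refine ⟨fun hor => hor.elim id fun hand => ?_, Or.inl⟩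
            exact absurd hand.2 (by rw [hpj.inj w hw u hu' hand.1]; simp)
          · have := hpj.off w hw
            simp only [hw, false_and, iff_false]
            omega
        · right; left
          have hge : (φ d : ℕ) ≤ φ u := not_lt.1 (mt (hXjd u).2 hu')
          have hun := hpj.off u hu'
          refine ⟨?_, hun, hge, huc⟩
          rw [arrange, if_pos hu, hun]
          rw [← card_filter_lt φ u]
          congr 1
          ext w
          simp only [mem_filter, mem_univ, true_and]
          by_cases hwi : w ∈ X i
          · by_cases hw : w ∈ X j
            · have h1 := (hXjd w).1 hw
              have h2 := (hpj.lt_card hw).trans_le hcard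
              have h3 : φ w < φ u := Fin.lt_def.2 (by omega)
              simp only [hwi, true_and, h3, iff_true]
              left; omega
            · have h1 := hpj.off w hw
              have htu : Twins G z u := by
                by_contra hcon; exact hu' ((hXj' u).2 ⟨hu, hcon⟩)
              have htw' : Twins G z w := by
                by_contra hcon; exact hw ((hXj' w).2 ⟨hwi, hcon⟩)
              rw [hs w u (htw _ _ fun x => (htw' x).symm.trans (htu x))]
              simp [hwi, h1]
          · have h1 : ¬ (φ w : ℕ) < c := mt (hXi w).2 hwi
            have h3 : ¬ φ w < φ u := fun hlt => by
              have := Fin.lt_def.1 hlt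
              omega
            simp [hwi, h3]
      · right; right
        have hw : u ∉ X j := fun hw => hu ((hXj' u).1 hw).1
        exact ⟨if_neg hu, hpj.off u hw, not_lt.1 (mt (hXjd u).2 hw), not_lt.1 (mt (hXi u).2 hu)⟩
    -- Appending the class changes both costs equally: an edge meeting the smaller set keeps its
    -- weight, and any other edge sees the same locations in `arrange` and in `φ`.
    have key : pairCost G (arrange (X i) (π j)) +
        pairCost G (fun v => if (φ v : ℕ) < φ d then φ v else n) =
        pairCost G (π j) + pairCost G (fun v => if (φ v : ℕ) < c then φ v else n) := by
      simp only [pairCost, ← sum_add_distrib]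
      refine sum_congr rfl fun u _ => sum_congr rfl fun v _ => ?_
      by_cases huv : G.Adj u v
      · simp only [huv, if_true]
        have hun := (φ u).2
        have hvn := (φ v).2
        rcases tri u with ⟨a1, a2, a3, a4⟩ | ⟨a1, a2, a3, a4⟩ | ⟨a1, a2, a3, a4⟩ <;>
          rcases tri v with ⟨b1, b2, b3, b4⟩ | ⟨b1, b2, b3, b4⟩ | ⟨b1, b2, b3, b4⟩ <;>
          rw [a1, b1] <;> split_ifs <;> omega
      · simp [huv]
    omega
  have huniv : ∀ v, v ∈ X (N - 1) := fun v => h.full v v.2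
  have hlast := hπ (N - 1) (by omega)
  have hlt : ∀ v, π (N - 1) v < n := fun v => by
    have := hlast.lt_card (huniv v)
    have := card_le_univ (X (N - 1))
    rw [Fintype.card_fin] at this
    omega
  have hinj : Function.Injective fun v => (⟨π (N - 1) v, hlt v⟩ : Fin n) := fun u w huw =>
    hlast.inj u (huniv u) w (huniv w) (Fin.ext_iff.1 huw)
  refine ⟨Equiv.ofBijective _ (Finite.injective_iff_bijective.1 hinj), fun v => rfl, fun χ => ?_⟩
  refine le_trans ?_ (ho χ)
  have h1 := main (N - 1) (by omega) n le_rfl fun v => by simp [huniv v]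
  have h2 := two_mul_cost_eq_pairCost G φ
  have h3 := two_mul_cost_eq_pairCost G
    (Equiv.ofBijective _ (Finite.injective_iff_bijective.1 hinj))
  simp only [Fin.is_lt, if_true] at h1
  rw [show (fun v => ((Equiv.ofBijective _ (Finite.injective_iff_bijective.1 hinj)) v : ℕ)) =
    π (N - 1) from rfl] at h3
  omega

end DynamicProgramming

end MSVC

/-! ### Running times and correctness rules for programs, and matrix access. -/

namespace RAM

/-- The registers that a program may change. -/
def Prog.regs : Prog → List ℕ
  | .skip => []
  | .const x _ => [x]
  | .copy x _ => [x]
  | .succ x => [x]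
  | .pred x => [x]
  | .load x _ _ => [x]
  | .store _ _ _ => []
  | .seq p q => p.regs ++ q.regs
  | .ite _ p q => p.regs ++ q.regs
  | .loop _ p => p.regs

/-- The arrays that a program may change. -/
def Prog.arrs : Prog → List ℕ
  | .store a _ _ => [a]
  | .seq p q => p.arrs ++ q.arrs
  | .ite _ p q => p.arrs ++ q.arrs
  | .loop _ p => p.arrs
  | _ => []

/-- A bound for the running time of a program all of whose loops are run at most `Z` times. -/
def Prog.timeBound (Z : ℕ) : Prog → ℕ
  | .seq p q => p.timeBound Z + q.timeBound Z
  | .ite _ p q => p.timeBound Z + q.timeBound Z + 1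
  | .loop _ p => Z * (p.timeBound Z + 1) + 1
  | _ => 1

/-- The number of instructions and tests of a program. -/
def Prog.size : Prog → ℕ
  | .seq p q => p.size + q.size + 1
  | .ite _ p q => p.size + q.size + 1
  | .loop _ p => p.size + 2
  | _ => 1

/-- The exponent depends only on the program, so bounding all loop counts by `Z` makes the time
polynomial in `Z`. -/
theorem Prog.timeBound_le (Z : ℕ) (p : Prog) : p.timeBound Z ≤ (Z + 3) ^ p.size := by
  have h1 : ∀ q : Prog, 1 ≤ (Z + 3) ^ q.size := fun q => Nat.one_le_pow _ _ (by omega)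
  have hpq : ∀ p q : Prog, p.timeBound Z ≤ (Z + 3) ^ p.size → q.timeBound Z ≤ (Z + 3) ^ q.size →
      p.timeBound Z + q.timeBound Z + 1 ≤ (Z + 3) ^ (p.size + q.size + 1) := by
    intro p q hp hq
    have := h1 p
    have := h1 q
    rw [pow_succ, pow_add]
    nlinarith [Nat.mul_le_mul (h1 p) (h1 q), Nat.mul_le_mul_left ((Z + 3) ^ p.size) (h1 q),
      Nat.mul_le_mul_right ((Z + 3) ^ q.size) (h1 p)]
  induction p with
  | seq p q hp hq => exact (Nat.le_succ _).trans (hpq p q hp hq)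
  | ite b p q hp hq => exact hpq p q hp hq
  | loop b p hp =>
    have := h1 p
    simp only [Prog.timeBound, Prog.size]
    have h2 : Z * p.timeBound Z ≤ Z * (Z + 3) ^ p.size := Nat.mul_le_mul_left Z hp
    calc Z * (p.timeBound Z + 1) + 1 ≤ (Z + 3) ^ p.size * (2 * Z + 1) := by nlinarith
      _ ≤ _ := by rw [pow_add]; exact Nat.mul_le_mul_left _ (by nlinarith)
  | _ => simp [Prog.timeBound, Prog.size]

@[simp] theorem State.reg_setReg (s : State) (x m y : ℕ) :
    (s.setReg x m).reg y = if y = x then m else s.reg y := by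
  simp [State.setReg, Function.update_apply]

@[simp] theorem State.arr_setReg (s : State) (x m : ℕ) : (s.setReg x m).arr = s.arr := rfl

@[simp] theorem State.arr_setArr (s : State) (a i m b j : ℕ) :
    (s.setArr a i m).arr b j = if b = a ∧ j = i then m else s.arr b j := by
  by_cases h : b = a
  · subst h; simp [State.setArr, Function.update_apply]
  · simp [State.setArr, h]

theorem Exec.frame {p : Prog} {s s' : State} {t : ℕ} (h : Exec p s s' t) :
    (∀ r ∉ p.regs, s'.reg r = s.reg r) ∧ ∀ a ∉ p.arrs, s'.arr a = s.arr a := by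
  induction h with
  | seq _ _ ih ih' =>
    simp only [Prog.regs, Prog.arrs, List.mem_append, not_or]
    exact ⟨fun r hr => (ih'.1 r hr.2).trans (ih.1 r hr.1),
      fun a ha => (ih'.2 a ha.2).trans (ih.2 a ha.1)⟩
  | ite_true _ _ ih =>
    simp only [Prog.regs, Prog.arrs, List.mem_append, not_or]
    exact ⟨fun r hr => ih.1 r hr.1, fun a ha => ih.2 a ha.1⟩
  | ite_false _ _ ih =>
    simp only [Prog.regs, Prog.arrs, List.mem_append, not_or]
    exact ⟨fun r hr => ih.1 r hr.2, fun a ha => ih.2 a ha.2⟩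
  | loop_true _ _ _ ih ih' =>
    exact ⟨fun r hr => (ih'.1 r hr).trans (ih.1 r hr),
      fun a ha => (ih'.2 a ha).trans (ih.2 a ha)⟩
  | store s a i x =>
    refine ⟨fun r _ => rfl, fun b hb => ?_⟩
    simp only [Prog.arrs, List.mem_singleton] at hb
    simp [State.setArr, hb]
  | _ => simp +contextual [Prog.regs]

/-- Started in `s`, the program `p` halts in a state that satisfies `Q`, its running time being at
most the one of a program all of whose loops are run at most `Z` times. -/
def Runs (Z : ℕ) (p : Prog) (s : State) (Q : State → Prop) : Prop :=
  ∃ s' t, Exec p s s' t ∧ t ≤ p.timeBound Z ∧ Q s'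

namespace Runs

variable {Z : ℕ} {p q : Prog} {s : State} {Q R : State → Prop}

theorem frame (h : Runs Z p s Q) (hR : ∀ s', (∀ r ∉ p.regs, s'.reg r = s.reg r) →
    (∀ a ∉ p.arrs, s'.arr a = s.arr a) → Q s' → R s') : Runs Z p s R := by
  obtain ⟨s', t, he, ht, hQ⟩ := h
  exact ⟨s', t, he, ht, hR s' he.frame.1 he.frame.2 hQ⟩

theorem skip (h : Q s) : Runs Z .skip s Q := ⟨_, _, .skip s, le_rfl, h⟩

theorem const {x m : ℕ} (h : Q (s.setReg x m)) : Runs Z (.const x m) s Q :=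
  ⟨_, _, .const s x m, le_rfl, h⟩

theorem copy {x y : ℕ} (h : Q (s.setReg x (s.reg y))) : Runs Z (.copy x y) s Q :=
  ⟨_, _, .copy s x y, le_rfl, h⟩

theorem succ {x : ℕ} (h : Q (s.setReg x (s.reg x + 1))) : Runs Z (.succ x) s Q :=
  ⟨_, _, .succ s x, le_rfl, h⟩

theorem pred {x : ℕ} (h : Q (s.setReg x (s.reg x - 1))) : Runs Z (.pred x) s Q :=
  ⟨_, _, .pred s x, le_rfl, h⟩

theorem load {x a i : ℕ} (h : Q (s.setReg x (s.arr a (s.reg i)))) : Runs Z (.load x a i) s Q :=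
  ⟨_, _, .load s x a i, le_rfl, h⟩

theorem store {a i x : ℕ} (h : Q (s.setArr a (s.reg i) (s.reg x))) : Runs Z (.store a i x) s Q :=
  ⟨_, _, .store s a i x, le_rfl, h⟩

theorem seq (h : Runs Z p s fun s' => Runs Z q s' Q) : Runs Z (.seq p q) s Q := by
  obtain ⟨s', t, he, ht, s'', t', he', ht', hQ⟩ := h
  exact ⟨s'', t + t', .seq he he', Nat.add_le_add ht ht', hQ⟩

theorem ite {b : Test} (h₁ : b.Holds s → Runs Z p s Q) (h₂ : ¬ b.Holds s → Runs Z q s Q) :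
    Runs Z (.ite b p q) s Q := by
  by_cases hb : b.Holds s
  · obtain ⟨s', t, he, ht, hQ⟩ := h₁ hb
    exact ⟨s', t + 1, .ite_true hb he, by simp only [Prog.timeBound]; omega, hQ⟩
  · obtain ⟨s', t, he, ht, hQ⟩ := h₂ hb
    exact ⟨s', t + 1, .ite_false hb he, by simp only [Prog.timeBound]; omega, hQ⟩

end Runs

/-- Run `p` for all values of the register `i` below the one of the register `N`. -/
def forLoop (i N : ℕ) (p : Prog) : Prog :=
  .seq (.const i 0) (.loop (.lt i N) (.seq p (.succ i)))

/-- The invariant takes the round number as an argument and must not depend on the counter register,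
which changes between rounds. Each step also learns that whatever `p` does not write is still as in
`s`. The proof is an induction on the number of remaining rounds. -/
theorem Runs.forLoop {Z i N : ℕ} {p : Prog} {s : State} {Q : State → Prop}
    (I : ℕ → State → Prop) (hiN : i ≠ N) (hi : i ∉ p.regs) (hN : N ∉ p.regs) (hZ : s.reg N ≤ Z)
    (hI : ∀ j s m, I j s → I j (s.setReg i m)) (h0 : I 0 s)
    (hstep : ∀ j s', j < s.reg N → s'.reg i = j → (∀ r, r ∉ i :: p.regs → s'.reg r = s.reg r) →
      (∀ a ∉ p.arrs, s'.arr a = s.arr a) → I j s' → Runs Z p s' (I (j + 1)))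
    (hQ : ∀ s', (∀ r, r ∉ i :: p.regs → s'.reg r = s.reg r) →
      (∀ a ∉ p.arrs, s'.arr a = s.arr a) → I (s.reg N) s' → Q s') :
    Runs Z (RAM.forLoop i N p) s Q := by
  have hNi : N ∉ i :: p.regs := by simp [hN, hiN.symm]
  have main : ∀ d j s', d + j = s.reg N → s'.reg i = j →
      (∀ r, r ∉ i :: p.regs → s'.reg r = s.reg r) →
      (∀ a ∉ p.arrs, s'.arr a = s.arr a) → I j s' →
      ∃ s'' t, Exec (.loop (.lt i N) (.seq p (.succ i))) s' s'' t ∧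
        t ≤ d * (p.timeBound Z + 2) + 1 ∧ Q s'' := by
    intro d
    induction d with
    | zero =>
      intro j s' hj hij hr ha hIj
      refine ⟨s', 1, .loop_false ?_, by omega, hQ s' hr ha (by rwa [← hj, zero_add])⟩
      simp only [Test.Holds, hij, hr N hNi]
      omega
    | succ d ih =>
      intro j s' hj hij hr ha hIj
      obtain ⟨s₁, t₁, he₁, ht₁, hI₁⟩ := hstep j s' (by omega) hij hr ha hIj
      have hf := he₁.frame
      obtain ⟨s₂, t₂, he₂, ht₂, hQ₂⟩ := ih (j + 1) (s₁.setReg i (s₁.reg i + 1)) (by omega)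
        (by simp [hf.1 i hi, hij])
        (fun r hri => by
          simp only [List.mem_cons, not_or] at hri
          simp only [State.reg_setReg, if_neg hri.1, hf.1 r hri.2]
          exact hr r (by simp [hri]))
        (fun a haa => by rw [State.arr_setReg, hf.2 a haa, ha a haa]) (hI _ _ _ hI₁)
      refine ⟨s₂, _, .loop_true ?_ (.seq he₁ (.succ s₁ i)) he₂, ?_, hQ₂⟩
      · simp only [Test.Holds, hij, hr N hNi]
        omega
      · rw [Nat.add_mul]
        omega
  obtain ⟨s', t, he, ht, hQ'⟩ := main (s.reg N) 0 (s.setReg i 0) (by omega) (by simp)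
    (fun r hr => by simp only [List.mem_cons, not_or] at hr; simp [hr.1]) (fun a _ => rfl)
    (hI _ _ _ h0)
  refine ⟨s', _, .seq (.const s i 0) he, ?_, hQ'⟩
  have := Nat.mul_le_mul_right (p.timeBound Z + 2) hZ
  change _ ≤ 1 + (Z * (p.timeBound Z + 2) + 1)
  omega

/-- Put the number of the entry `(i, j)` of a matrix with `reg 0` columns into register `20`. -/
def index (i j : ℕ) : Prog :=
  .seq (.const 20 0) (.seq (forLoop 21 i (forLoop 22 0 (.succ 20))) (forLoop 21 j (.succ 20)))

/-- Without multiplication the index is counted up by nested loops, so row numbers must be at most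
`Z` too. The values `b` and `c` are leftovers of the loop counters. -/
theorem Runs.index {Z i j : ℕ} {s : State} {Q : State → Prop}
    (hi : i ∉ [20, 21, 22]) (hj : j ∉ [20, 21, 22])
    (h0 : s.reg 0 ≤ Z) (hiZ : s.reg i ≤ Z) (hjZ : s.reg j ≤ Z)
    (hQ : ∀ b c, Q (((s.setReg 21 b).setReg 22 c).setReg 20 (s.reg i * s.reg 0 + s.reg j))) :
    Runs Z (RAM.index i j) s Q := by
  simp only [List.mem_cons, List.not_mem_nil, or_false, not_or] at hi hj
  have key : Runs Z (RAM.index i j) s fun s' => s'.reg 20 = s.reg i * s.reg 0 + s.reg j := by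
    refine .seq (.const (.seq (.forLoop (fun m s' => s'.reg 20 = m * s.reg 0) (Ne.symm hi.2.1)
      (by decide) (by simp [RAM.forLoop, Prog.regs, hi]) (by simpa [hi] using hiZ) (by simp)
      (by simp) (fun m s' _ _ hr ha hm => ?_) fun s' hr ha hm => ?_)))
    · have e0 : s'.reg 0 = s.reg 0 := by rw [hr 0 (by decide)]; simp
      refine .forLoop (fun l s'' => s''.reg 20 = m * s.reg 0 + l) (by decide) (by decide)
        (by decide) (by rwa [e0]) (by simp) (by simpa using hm)
        (fun l s'' _ _ _ _ hl => .succ (by simp [hl, add_assoc])) fun s'' _ _ hl => ?_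
      rw [hl, e0, Nat.succ_mul]
    · have ej : s'.reg j = s.reg j := by
        rw [hr j (by simp [RAM.forLoop, Prog.regs, hj])]; simp [hj]
      rw [State.reg_setReg, if_neg hi.1] at hm
      refine .forLoop (fun l s'' => s''.reg 20 = s.reg i * s.reg 0 + l) (Ne.symm hj.2.1)
        (by decide) (by simp [Prog.regs, hj]) (by rwa [ej]) (by simp) (by simpa using hm)
        (fun l s'' _ _ _ _ hl => .succ (by simp [hl, add_assoc])) fun s'' _ _ hl => ?_
      rw [hl, ej]
  refine key.frame fun s' hr ha h => ?_
  convert hQ (s'.reg 21) (s'.reg 22) using 1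
  refine State.ext (funext fun r => ?_) (funext fun a => ha a ?_)
  · simp only [State.reg_setReg]
    split_ifs with h1 h2 h3
    · rw [h1, h]
    · rw [h2]
    · rw [h3]
    · exact hr r (by simp [RAM.index, RAM.forLoop, Prog.regs, h1, h2, h3])
  · simp [RAM.index, RAM.forLoop, Prog.arrs]

/-- Load the entry `(i, j)` of the matrix in array `a`. -/
def load2 (x a i j : ℕ) : Prog := .seq (index i j) (.load x a 20)

/-- Store register `x` to the entry `(i, j)` of the matrix in array `a`. -/
def store2 (a i j x : ℕ) : Prog := .seq (index i j) (.store a 20 x)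

theorem Runs.load2 {Z x a i j m k l v : ℕ} {s : State} {Q : State → Prop}
    (hi : i ∉ [20, 21, 22]) (hj : j ∉ [20, 21, 22])
    (e0 : s.reg 0 = m) (ei : s.reg i = k) (ej : s.reg j = l) (ev : s.arr a (k * m + l) = v)
    (h0 : m ≤ Z) (hiZ : k ≤ Z) (hjZ : l ≤ Z)
    (hQ : ∀ b c d, Q ((((s.setReg 21 b).setReg 22 c).setReg 20 d).setReg x v)) :
    Runs Z (RAM.load2 x a i j) s Q := by
  subst e0 ei ej ev
  exact .seq (.index hi hj h0 hiZ hjZ fun b c => .load (by simpa using hQ b c _))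

theorem Runs.store2 {Z x a i j m k l v : ℕ} {s : State} {Q : State → Prop}
    (hi : i ∉ [20, 21, 22]) (hj : j ∉ [20, 21, 22]) (hx : x ∉ [20, 21, 22])
    (e0 : s.reg 0 = m) (ei : s.reg i = k) (ej : s.reg j = l) (ex : s.reg x = v)
    (h0 : m ≤ Z) (hiZ : k ≤ Z) (hjZ : l ≤ Z)
    (hQ : ∀ b c d, Q ((((s.setReg 21 b).setReg 22 c).setReg 20 d).setArr a (k * m + l) v)) :
    Runs Z (RAM.store2 a i j x) s Q := by
  subst e0 ei ej ex
  simp only [List.mem_cons, List.not_mem_nil, or_false, not_or] at hx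
  exact .seq (.index hi hj h0 hiZ hjZ fun b c => .store (by simpa [hx] using hQ b c _))

end RAM

/-! ### Subroutines for the cost and for arranging a set. -/

namespace RAM

open Classical Finset MSVC

variable {n : ℕ}

/-- The sum of the first `j` values of a function on `Fin n`. -/
def partialSum (f : Fin n → ℕ) (j : ℕ) : ℕ := ∑ u : Fin n, if (u : ℕ) < j then f u else 0

theorem partialSum_zero (f : Fin n → ℕ) : partialSum f 0 = 0 := by simp [partialSum]

theorem partialSum_succ (f : Fin n → ℕ) (v : Fin n) :
    partialSum f (v + 1) = partialSum f v + f v := by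
  have h : f v = ∑ u : Fin n, if u = v then f u else 0 := by simp
  rw [h, partialSum, partialSum, ← sum_add_distrib]
  refine sum_congr rfl fun u _ => ?_
  rcases lt_trichotomy u v with h | h | h
  · have h' : (u : ℕ) < v := h
    rw [if_pos (by omega), if_pos h', if_neg h.ne, add_zero]
  · subst h; simp
  · have h' : (v : ℕ) < u := h
    rw [if_neg (by omega), if_neg (by omega), if_neg h.ne']

theorem partialSum_self (f : Fin n → ℕ) : partialSum f n = ∑ u, f u := by simp [partialSum]

/-- Compute the cost of row `reg 16` of array `2`, for the graph in array `0`. -/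
def costProg : Prog :=
  .seq (.const 11 0) (forLoop 5 0 (forLoop 6 0 (
    .seq (load2 7 0 5 6) (.ite (.eq 7 15) .skip (
      .seq (load2 8 2 16 5) (.seq (load2 9 2 16 6) (.seq (.ite (.lt 8 9) (.copy 9 8) .skip)
        (forLoop 10 9 (.succ 11)))))))))

/-- Row `i` of the matrix in array `2`. -/
def row (n : ℕ) (s : State) (i : ℕ) (u : Fin n) : ℕ := s.arr 2 (i * n + u)

/-- The set of the nonzero positions of row `i` of the matrix in array `3`. -/
def rowSet (n : ℕ) (s : State) (i : ℕ) : Finset (Fin n) := {u | s.arr 3 (i * n + u) ≠ 0}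

theorem mem_rowSet {s : State} {i : ℕ} {u : Fin n} :
    u ∈ rowSet n s i ↔ s.arr 3 (i * n + u) ≠ 0 := by simp [rowSet]

theorem row_congr {s s' : State} (h : s'.arr 2 = s.arr 2) : row n s' = row n s := by
  funext i u; rw [row, row, h]

theorem rowSet_congr {s s' : State} (h : s'.arr 3 = s.arr 3) : rowSet n s' = rowSet n s := by
  funext i; rw [rowSet, rowSet, h]

@[simp] theorem row_setReg (s : State) (x m : ℕ) : row n (s.setReg x m) = row n s := rfl

@[simp] theorem rowSet_setReg (s : State) (x m : ℕ) : rowSet n (s.setReg x m) = rowSet n s := rfl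

theorem entry_inj {i j : ℕ} {u v : Fin n} (h : i * n + (u : ℕ) = j * n + v) : i = j ∧ u = v := by
  have hn : 0 < n := u.pos
  have h1 := congrArg (· / n) h
  simp only [mul_comm _ n, Nat.mul_add_div hn, Nat.div_eq_of_lt u.2, Nat.div_eq_of_lt v.2,
    add_zero] at h1
  subst h1
  exact ⟨rfl, Fin.ext (by omega)⟩

/-- Array `0` holds the adjacency matrix of `G`, and register `15` holds the number zero. -/
structure HoldsGraph (G : SimpleGraph (Fin n)) (s : State) : Prop where
  size : s.reg 0 = n
  zero : s.reg 15 = 0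
  adj : ∀ u v : Fin n, s.arr 0 (u * n + v) = if G.Adj u v then 1 else 0

theorem HoldsGraph.congr {G : SimpleGraph (Fin n)} {s s' : State} (h : HoldsGraph G s)
    (h0 : s'.reg 0 = s.reg 0) (h15 : s'.reg 15 = s.reg 15) (ha : s'.arr 0 = s.arr 0) :
    HoldsGraph G s' :=
  ⟨h0.trans h.size, h15.trans h.zero, fun u v => by rw [ha, h.adj]⟩

/-- Each minimum is added by a loop of that many increments, which is why the entries of the row
must be at most `Z`. -/
theorem runs_costProg {G : SimpleGraph (Fin n)} {Z : ℕ} {s : State} (hG : HoldsGraph G s)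
    (hn : n ≤ Z) (hj : s.reg 16 ≤ Z) (hA : ∀ u, row n s (s.reg 16) u ≤ Z) :
    Runs Z costProg s fun s' => s'.reg 11 = pairCost G (row n s (s.reg 16)) := by
  set f : Fin n → Fin n → ℕ := fun u v =>
    if G.Adj u v then min (s.arr 2 (s.reg 16 * n + u)) (s.arr 2 (s.reg 16 * n + v)) else 0 with hf
  have h0 := hG.size
  refine .seq (.const (.forLoop (fun j s' => s'.reg 11 = partialSum (fun u => ∑ v, f u v) j)
    (by decide) (by decide) (by decide) (by simpa [h0] using hn) (by simp)
    (by simp [partialSum_zero]) (fun j s₁ hjn h5 hr₁ ha₁ hI₁ => ?_) fun s' _ _ h => ?_))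
  · have e0 : s₁.reg 0 = n := by rw [hr₁ 0 (by decide)]; simp [h0]
    have e15 : s₁.reg 15 = 0 := by rw [hr₁ 15 (by decide)]; simp [hG.zero]
    have e16 : s₁.reg 16 = s.reg 16 := by rw [hr₁ 16 (by decide)]; simp
    have a0 : s₁.arr 0 = s.arr 0 := by rw [ha₁ 0 (by decide)]; simp
    have a2 : s₁.arr 2 = s.arr 2 := by rw [ha₁ 2 (by decide)]; simp
    simp only [State.reg_setReg, h0] at hjn
    norm_num at hjn
    refine .forLoop (fun l s' => s'.reg 11 = partialSum (fun u => ∑ v, f u v) j +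
      partialSum (f ⟨j, hjn⟩) l) (by decide) (by decide) (by decide) (by rwa [e0]) (by simp)
      (by simpa [partialSum_zero] using hI₁) (fun l s₂ hl h6 hr₂ ha₂ hI₂ => ?_)
      fun s' _ _ h => ?_
    · have d0 : s₂.reg 0 = n := by rw [hr₂ 0 (by decide), e0]
      have d5 : s₂.reg 5 = j := by rw [hr₂ 5 (by decide), h5]
      have d15 : s₂.reg 15 = 0 := by rw [hr₂ 15 (by decide), e15]
      have d16 : s₂.reg 16 = s.reg 16 := by rw [hr₂ 16 (by decide), e16]
      have b0 : s₂.arr 0 = s.arr 0 := by rw [ha₂ 0 (by decide), a0]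
      have b2 : s₂.arr 2 = s.arr 2 := by rw [ha₂ 2 (by decide), a2]
      rw [e0] at hl
      have hs := partialSum_succ (f ⟨j, hjn⟩) ⟨l, hl⟩
      simp only at hs
      have hadj := hG.adj ⟨j, hjn⟩ ⟨l, hl⟩
      simp only at hadj
      have hAj := hA ⟨j, hjn⟩
      have hAl := hA ⟨l, hl⟩
      simp only [row] at hAj hAl
      refine .seq (.load2 (by decide) (by decide) d0 d5 h6 (by rw [b0, hadj]) hn (by omega)
        (by omega) fun b c d => .ite (fun ht => .skip ?_) (fun ht => ?_))
      · simp [Test.Holds, d15] at ht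
        have hz : f ⟨j, hjn⟩ ⟨l, hl⟩ = 0 := by simp [hf, ht]
        simp [hI₂, hs, hz]
      · simp [Test.Holds, d15] at ht
        refine .seq (.load2 (by decide) (by decide) (m := n) (k := s.reg 16) (l := j)
          (by simp [d0]) (by simp [d16]) (by simp [d5]) (by simp [b2]; rfl) hn hj (by omega)
          fun b c d => .seq (.load2 (by decide) (by decide) (m := n) (k := s.reg 16) (l := l)
          (by simp [d0]) (by simp [d16]) (by simp [h6]) (by simp [b2]; rfl) hn hj (by omega)
          fun b c d => .seq ?_))
        have fin : ∀ s₃ : State, s₃.reg 9 = f ⟨j, hjn⟩ ⟨l, hl⟩ → s₃.reg 11 = s₂.reg 11 →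
            Runs Z (RAM.forLoop 10 9 (.succ 11)) s₃ fun s' => s'.reg 11 =
              partialSum (fun u => ∑ v, f u v) j + partialSum (f ⟨j, hjn⟩) (l + 1) := by
          intro s₃ h9 h11
          refine .forLoop (fun m s' => s'.reg 11 = s₂.reg 11 + m) (by decide) (by decide)
            (by decide) ?_ (by simp) (by simpa using h11)
            (fun m s' _ _ _ _ hm => .succ (by simp [hm, add_assoc])) fun s' _ _ hm => ?_
          · rw [h9, hf]
            simp only [ht, if_true]
            omega
          · rw [hm, hI₂, h9, hs, add_assoc]
        refine .ite (fun hlt => .copy (fin _ ?_ (by simp))) (fun hlt => .skip (fin _ ?_ (by simp)))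
        · simp [Test.Holds] at hlt
          simp [hf, ht, hlt.le]
        · simp [Test.Holds] at hlt
          simp [hf, ht, hlt]
    · rw [h, e0, partialSum_self]
      exact (partialSum_succ (fun u => ∑ v, f u v) ⟨j, hjn⟩).symm
  · rw [h]
    simp only [State.reg_setReg, h0]
    norm_num
    rw [partialSum_self]
    rfl

/-- Let row `reg 18` of array `2` be the arrangement of the set in row `reg 17` of array `3` by the
row `reg 16` of array `2`. -/
def arrangeProg : Prog :=
  forLoop 5 0 (.seq (load2 7 3 17 5) (.seq (.ite (.eq 7 15) (.copy 8 0)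
    (.seq (load2 9 2 16 5) (.seq (.const 8 0) (forLoop 6 0 (.seq (load2 7 3 17 6)
      (.ite (.eq 7 15) .skip (.seq (load2 10 2 16 6) (.ite (.lt 10 9) (.succ 8)
        (.ite (.eq 10 9) (.ite (.lt 6 5) (.succ 8) .skip) .skip)))))))))
    (store2 2 18 5 8)))

theorem arrange_eq_partialSum {X : Finset (Fin n)} {π : Fin n → ℕ} {u : Fin n} (hu : u ∈ X) :
    arrange X π u =
      partialSum (fun w => if w ∈ X ∧ (π w < π u ∨ π w = π u ∧ w < u) then 1 else 0) n := by
  rw [arrange, if_pos hu, partialSum_self, ← card_filter]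
  congr 1
  ext w
  simp

/-- The source row is read while the target row is being written, so the two must differ. -/
theorem runs_arrangeProg {Z : ℕ} {s : State} (h0 : s.reg 0 = n) (h15 : s.reg 15 = 0)
    (hn : n ≤ Z) (h16 : s.reg 16 ≤ Z) (h17 : s.reg 17 ≤ Z) (h18 : s.reg 18 ≤ Z)
    (hne : s.reg 16 ≠ s.reg 18) :
    Runs Z arrangeProg s fun s' =>
      row n s' (s.reg 18) = arrange (rowSet n s (s.reg 17)) (row n s (s.reg 16)) ∧
      ∀ i ≠ s.reg 18, row n s' i = row n s i := by
  set X := rowSet n s (s.reg 17) with hX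
  set π := row n s (s.reg 16) with hπ
  refine .forLoop (fun j s' => (∀ u : Fin n, (u : ℕ) < j → row n s' (s.reg 18) u = arrange X π u) ∧
      ∀ i ≠ s.reg 18, row n s' i = row n s i)
    (by decide) (by decide) (by decide) (by rwa [h0]) (fun _ _ _ h => h)
    ⟨fun u hu => absurd hu (Nat.not_lt_zero _), fun _ _ => rfl⟩
    (fun j s₁ hjn h5 hr₁ ha₁ hI₁ => ?_) fun s' _ _ h => ?_
  · rw [h0] at hjn
    have e0 : s₁.reg 0 = n := by rw [hr₁ 0 (by decide), h0]
    have e15 : s₁.reg 15 = 0 := by rw [hr₁ 15 (by decide), h15]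
    have e16 : s₁.reg 16 = s.reg 16 := hr₁ 16 (by decide)
    have e17 : s₁.reg 17 = s.reg 17 := hr₁ 17 (by decide)
    have e18 : s₁.reg 18 = s.reg 18 := hr₁ 18 (by decide)
    have a3 : s₁.arr 3 = s.arr 3 := ha₁ 3 (by decide)
    have hrow : ∀ w : Fin n, s₁.arr 2 (s.reg 16 * n + w) = π w := fun w =>
      congrFun (hI₁.2 _ hne) w
    have hmem : ∀ w : Fin n, s₁.arr 3 (s.reg 17 * n + w) ≠ 0 ↔ w ∈ X := fun w => by
      rw [hX, mem_rowSet, a3]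
    have fin : ∀ s₃ : State, s₃.reg 8 = arrange X π ⟨j, hjn⟩ → s₃.reg 0 = n → s₃.reg 5 = j →
        s₃.reg 18 = s.reg 18 → s₃.arr 2 = s₁.arr 2 → Runs Z (store2 2 18 5 8) s₃ fun s' =>
          (∀ u : Fin n, (u : ℕ) < j + 1 → row n s' (s.reg 18) u = arrange X π u) ∧
            ∀ i ≠ s.reg 18, row n s' i = row n s i := by
      intro s₃ g8 g0 g5 g18 g2
      refine .store2 (by decide) (by decide) (by decide) g0 g18 g5 g8 hn h18 (by omega)
        fun b c d => ⟨fun u hu => ?_, fun i hi => funext fun u => ?_⟩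
      · simp only [row, State.arr_setArr, State.arr_setReg]
        split_ifs with h
        · rw [show u = ⟨j, hjn⟩ from Fin.ext (by have := h.2; simp only; omega)]
        · rw [g2]
          refine hI₁.1 u ?_
          have : (u : ℕ) ≠ j := fun e => h ⟨trivial, by rw [e]⟩
          omega
      · simp only [row, State.arr_setArr, State.arr_setReg]
        rw [if_neg, g2]
        · exact congrFun (hI₁.2 i hi) u
        · rintro ⟨-, h⟩
          exact hi (entry_inj (u := u) (v := ⟨j, hjn⟩) (by simpa using h)).1
    refine .seq (.load2 (by decide) (by decide) e0 e17 h5 rfl hn h17 (by omega) fun b c d =>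
      .seq (.ite (fun ht => .copy ?_) fun ht => ?_))
    · simp [Test.Holds, e15] at ht
      have hu : (⟨j, hjn⟩ : Fin n) ∉ X := fun h => (hmem ⟨j, hjn⟩).2 h ht
      exact fin _ (by simp [arrange, hu, e0]) (by simp [e0]) (by simp [h5]) (by simp [e18]) rfl
    · simp [Test.Holds, e15] at ht
      have hu : (⟨j, hjn⟩ : Fin n) ∈ X := (hmem ⟨j, hjn⟩).1 ht
      refine .seq (.load2 (by decide) (by decide) (m := n) (k := s.reg 16) (l := j)
        (by simp [e0]) (by simp [e16]) (by simp [h5]) (hrow ⟨j, hjn⟩) hn h16 (by omega)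
        fun b c d => .seq (.const ?_))
      set P : Fin n → Prop := fun w => w ∈ X ∧ (π w < π ⟨j, hjn⟩ ∨ π w = π ⟨j, hjn⟩ ∧ w < ⟨j, hjn⟩)
        with hP
      refine .forLoop (fun l s' => s'.reg 8 = partialSum (fun w => if P w then 1 else 0) l)
        (by decide) (by decide) (by decide) (by simp; omega) (by simp)
        (by simp [partialSum_zero]) (fun l s₂ hl h6 hr₂ ha₂ hI₂ => ?_) fun s₂ hr₂ ha₂ hI₂ => ?_
      · have d0 := hr₂ 0 (by decide)
        have d5 := hr₂ 5 (by decide)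
        have d9 := hr₂ 9 (by decide)
        have d15 := hr₂ 15 (by decide)
        have d16 := hr₂ 16 (by decide)
        have d17 := hr₂ 17 (by decide)
        have b2 := ha₂ 2 (by decide)
        have b3 := ha₂ 3 (by decide)
        simp only [State.reg_setReg, State.arr_setReg, e0, h5, e15, e16, e17] at d0 d5 d9 d15 d16 d17 b2 b3 hl
        norm_num at d0 d5 d9 d15 d16 d17 hl
        have hs := partialSum_succ (fun w => if P w then 1 else 0) ⟨l, hl⟩
        simp only at hs
        have hml := hmem ⟨l, hl⟩
        have hrl := hrow ⟨l, hl⟩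
        simp only at hml hrl
        have hyes : P ⟨l, hl⟩ → ∀ s₃ : State, s₃.reg 8 = s₂.reg 8 → Runs Z (.succ 8) s₃
            fun s' => s'.reg 8 = partialSum (fun w => if P w then 1 else 0) (l + 1) := by
          intro hp s₃ g8
          exact .succ (by simp [hs, hp, g8, hI₂])
        have hno : ¬ P ⟨l, hl⟩ → ∀ s₃ : State, s₃.reg 8 = s₂.reg 8 → Runs Z .skip s₃
            fun s' => s'.reg 8 = partialSum (fun w => if P w then 1 else 0) (l + 1) := by
          intro hp s₃ g8
          exact .skip (by simp [hs, hp, g8, hI₂])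
        refine .seq (.load2 (by decide) (by decide) d0 d17 h6 (by rw [b3]) hn h17 (by omega)
          fun b c d => .ite (fun ht => hno ?_ _ (by simp)) fun ht => ?_)
        · simp [Test.Holds, d15] at ht
          exact fun hp => hml.2 hp.1 ht
        · simp [Test.Holds, d15] at ht
          have hlX := hml.1 ht
          refine .seq (.load2 (by decide) (by decide) (m := n) (k := s.reg 16) (l := l)
            (by simp [d0]) (by simp [d16]) (by simp [h6]) (by simp [b2, hrl]; rfl) hn h16 (by omega)
            fun b c d => .ite (fun ht₁ => hyes ?_ _ (by simp)) fun ht₁ =>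
              .ite (fun ht₂ => .ite (fun ht₃ => hyes ?_ _ (by simp)) fun ht₃ =>
                hno ?_ _ (by simp)) fun ht₂ => hno ?_ _ (by simp))
          · simp [Test.Holds, d9] at ht₁
            simp [hP, hlX, ht₁]
          · simp [Test.Holds, d9] at ht₂
            simp [Test.Holds, d5, h6] at ht₃
            simp [hP, hlX, ht₂, ht₃]
          · simp [Test.Holds, d9] at ht₂
            simp [Test.Holds, d5, h6] at ht₃
            simp [hP, ht₂, ht₃]
          · simp [Test.Holds, d9] at ht₁
            simp [Test.Holds, d9] at ht₂
            simp [hP, ht₂, ht₁]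
      · have d0 := hr₂ 0 (by decide)
        have d5 := hr₂ 5 (by decide)
        have d18 := hr₂ 18 (by decide)
        have b2 := ha₂ 2 (by decide)
        simp only [State.reg_setReg, State.arr_setReg, e0, h5, e18] at d0 d5 d18 b2 hI₂
        norm_num at d0 d5 d18 hI₂
        exact fin _ (by rw [hI₂, arrange_eq_partialSum hu]) d0 d5 d18 b2
  · rw [h0] at h
    exact ⟨funext fun u => h.1 u u.2, h.2⟩

end RAM

/-! ### Listing the twin closed sets and searching for their best orderings. -/

namespace RAM

open Classical Finset MSVC

variable {n : ℕ}

/-- Let row `reg 4` of array `3` be the union of row `reg 3` and the twins of the vertex `reg 2`. -/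
def unionProg : Prog :=
  forLoop 5 0 (.seq (.const 8 1) (.seq (forLoop 6 0 (.seq (load2 7 0 5 6) (.seq (load2 9 0 2 6)
    (.ite (.eq 7 9) .skip (.const 8 0))))) (.seq (.ite (.eq 8 15) (load2 8 3 3 5) .skip)
      (store2 3 4 5 8))))

theorem runs_unionProg {G : SimpleGraph (Fin n)} {Z : ℕ} {s : State} (hG : HoldsGraph G s)
    (hn : n ≤ Z) {v : Fin n} (hv : s.reg 2 = v) (h3 : s.reg 3 ≤ Z) (h4 : s.reg 4 ≤ Z)
    (hne : s.reg 3 ≠ s.reg 4) :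
    Runs Z unionProg s fun s' =>
      (∀ u, u ∈ rowSet n s' (s.reg 4) ↔ Twins G u v ∨ u ∈ rowSet n s (s.reg 3)) ∧
      ∀ i ≠ s.reg 4, rowSet n s' i = rowSet n s i := by
  have h0 := hG.size
  refine .forLoop (fun j s' => (∀ u : Fin n, (u : ℕ) < j → (u ∈ rowSet n s' (s.reg 4) ↔
        Twins G u v ∨ u ∈ rowSet n s (s.reg 3))) ∧ ∀ i ≠ s.reg 4, ∀ u : Fin n,
          s'.arr 3 (i * n + u) = s.arr 3 (i * n + u))
    (by decide) (by decide) (by decide) (by rwa [h0]) (fun _ _ _ h => h)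
    ⟨fun u hu => absurd hu (Nat.not_lt_zero _), fun _ _ _ => rfl⟩
    (fun j s₁ hjn h5 hr₁ ha₁ hI₁ => ?_) fun s' _ _ h => ?_
  · rw [h0] at hjn
    have e0 : s₁.reg 0 = n := by rw [hr₁ 0 (by decide), h0]
    have e2 : s₁.reg 2 = v := by rw [hr₁ 2 (by decide), hv]
    have e15 : s₁.reg 15 = 0 := by rw [hr₁ 15 (by decide), hG.zero]
    have e3 : s₁.reg 3 = s.reg 3 := hr₁ 3 (by decide)
    have e4 : s₁.reg 4 = s.reg 4 := hr₁ 4 (by decide)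
    have a0 : s₁.arr 0 = s.arr 0 := ha₁ 0 (by decide)
    have hvn := v.2
    have fin : ∀ s₃ : State, (s₃.reg 8 ≠ 0 ↔ Twins G ⟨j, hjn⟩ v ∨
        (⟨j, hjn⟩ : Fin n) ∈ rowSet n s (s.reg 3)) → s₃.reg 0 = n → s₃.reg 5 = j →
        s₃.reg 4 = s.reg 4 → s₃.arr 3 = s₁.arr 3 → Runs Z (store2 3 4 5 8) s₃ fun s' =>
          (∀ u : Fin n, (u : ℕ) < j + 1 → (u ∈ rowSet n s' (s.reg 4) ↔
            Twins G u v ∨ u ∈ rowSet n s (s.reg 3))) ∧ ∀ i ≠ s.reg 4, ∀ u : Fin n,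
              s'.arr 3 (i * n + u) = s.arr 3 (i * n + u) := by
      intro s₃ g8 g0 g5 g4 g3
      refine .store2 (by decide) (by decide) (by decide) g0 g4 g5 rfl hn h4 (by omega)
        fun b c d => ⟨fun u hu => ?_, fun i hi u => ?_⟩
      · simp only [mem_rowSet, State.arr_setArr, State.arr_setReg]
        split_ifs with h
        · rw [show u = ⟨j, hjn⟩ from Fin.ext (by have := h.2; simp only; omega), g8, mem_rowSet]
        · have hj : (u : ℕ) ≠ j := fun e => h ⟨trivial, by rw [e]⟩
          have := hI₁.1 u (by omega)
          simp only [mem_rowSet] at this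
          rw [g3, this]
      · simp only [State.arr_setArr, State.arr_setReg]
        rw [if_neg, g3]
        · exact hI₁.2 i hi u
        · rintro ⟨-, h⟩
          exact hi (entry_inj (u := u) (v := ⟨j, hjn⟩) (by simpa using h)).1
    refine .seq (.const (.seq (.forLoop (fun l s' => s'.reg 8 =
        if ∀ x : Fin n, (x : ℕ) < l → (G.Adj ⟨j, hjn⟩ x ↔ G.Adj v x) then 1 else 0)
      (by decide) (by decide) (by decide) (by simpa [e0] using hn) (by simp) (by simp)
      (fun l s₂ hl h6 hr₂ ha₂ hI₂ => ?_) fun s₂ hr₂ ha₂ hI₂ => .seq ?_)))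
    · have d0 : s₂.reg 0 = n := by rw [hr₂ 0 (by decide)]; simp [e0]
      have d2 : s₂.reg 2 = v := by rw [hr₂ 2 (by decide)]; simp [e2]
      have d5 : s₂.reg 5 = j := by rw [hr₂ 5 (by decide)]; simp [h5]
      have b0 : s₂.arr 0 = s.arr 0 := by rw [ha₂ 0 (by decide)]; simp [a0]
      have hl : l < n := by simpa [e0] using hl
      have hstep : (∀ x : Fin n, (x : ℕ) < l + 1 → (G.Adj ⟨j, hjn⟩ x ↔ G.Adj v x)) ↔
          (∀ x : Fin n, (x : ℕ) < l → (G.Adj ⟨j, hjn⟩ x ↔ G.Adj v x)) ∧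
            (G.Adj ⟨j, hjn⟩ ⟨l, hl⟩ ↔ G.Adj v ⟨l, hl⟩) := by
        refine ⟨fun h => ⟨fun x hx => h x (by omega), h _ (by simp)⟩, fun h x hx => ?_⟩
        rcases Nat.lt_succ_iff_lt_or_eq.1 hx with hx | hx
        · exact h.1 x hx
        · rw [show x = ⟨l, hl⟩ from Fin.ext hx]; exact h.2
      refine .seq (.load2 (by decide) (by decide) d0 d5 h6
        (v := if G.Adj ⟨j, hjn⟩ ⟨l, hl⟩ then 1 else 0) (by rw [b0]; exact hG.adj ⟨j, hjn⟩ ⟨l, hl⟩) hn (by omega) (by omega) fun b c d =>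
        .seq (.load2 (by decide) (by decide) (m := n) (k := v) (l := l) (by simp [d0])
          (by simp [d2]) (by simp [h6]) (by simp only [State.arr_setReg, b0]; exact hG.adj v ⟨l, hl⟩)
          hn (by omega) (by omega) fun b c d => .ite (fun ht => .skip ?_) fun ht => .const ?_))
      · have ht' : G.Adj ⟨j, hjn⟩ ⟨l, hl⟩ ↔ G.Adj v ⟨l, hl⟩ := by
          simp only [Test.Holds, State.reg_setReg] at ht
          by_cases h1 : G.Adj ⟨j, hjn⟩ ⟨l, hl⟩ <;> by_cases h2 : G.Adj v ⟨l, hl⟩ <;>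
            simp_all
        simp only [State.reg_setReg, hstep, ht', and_true]
        simpa using hI₂
      · have ht' : ¬ (G.Adj ⟨j, hjn⟩ ⟨l, hl⟩ ↔ G.Adj v ⟨l, hl⟩) := by
          intro h
          apply ht
          simp [Test.Holds, h]
        simp only [State.reg_setReg, hstep, ht', and_false]
        simp
    · have d0 : s₂.reg 0 = n := by rw [hr₂ 0 (by decide)]; simp [e0]
      have d3 : s₂.reg 3 = s.reg 3 := by rw [hr₂ 3 (by decide)]; simp [e3]
      have d4 : s₂.reg 4 = s.reg 4 := by rw [hr₂ 4 (by decide)]; simp [e4]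
      have d5 : s₂.reg 5 = j := by rw [hr₂ 5 (by decide)]; simp [h5]
      have d15 : s₂.reg 15 = 0 := by rw [hr₂ 15 (by decide)]; simp [e15]
      have b3 : s₂.arr 3 = s₁.arr 3 := by rw [ha₂ 3 (by decide)]; simp
      have hI₃ : s₂.reg 8 = if Twins G ⟨j, hjn⟩ v then 1 else 0 := by
        have ht : (∀ x : Fin n, (x : ℕ) < (s₁.setReg 8 1).reg 0 →
            (G.Adj ⟨j, hjn⟩ x ↔ G.Adj v x)) ↔ Twins G ⟨j, hjn⟩ v := by simp [e0, Twins]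
        rw [hI₂]
        by_cases h : Twins G ⟨j, hjn⟩ v
        · rw [if_pos (ht.2 h), if_pos h]
        · rw [if_neg (mt ht.1 h), if_neg h]
      refine .ite (fun ht => ?_) fun ht => .skip (fin _ ?_ d0 d5 d4 b3)
      · simp only [Test.Holds, hI₃, d15] at ht
        have ht' : ¬ Twins G ⟨j, hjn⟩ v := fun h => by simp [h] at ht
        refine .load2 (by decide) (by decide) d0 d3 d5
          (v := s.arr 3 (s.reg 3 * n + j)) (by rw [b3]; exact hI₁.2 _ hne ⟨j, hjn⟩) hn h3 (by omega)
          fun b c d => fin _ ?_ (by simp [d0]) (by simp [d5]) (by simp [d4]) b3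
        simp [ht', mem_rowSet]
      · simp only [Test.Holds, hI₃, d15] at ht
        have ht' : Twins G ⟨j, hjn⟩ v := by by_contra h; simp [h] at ht
        simp [hI₃, ht']
  · rw [h0] at h
    exact ⟨fun u => h.1 u u.2, fun i hi => by
      ext u; rw [mem_rowSet, mem_rowSet, h.2 i hi u]⟩

/-- List the twin closed sets in array `3`, and their number in register `1`. -/
def listProg : Prog :=
  .seq (.const 1 1) (forLoop 2 0 (.seq (.copy 11 1) (.seq (.pred 11) (.seq (load2 7 3 11 2)
    (.ite (.eq 7 15) (.seq (.copy 4 1) (.seq (forLoop 3 1 (.seq unionProg (.succ 4)))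
      (.copy 1 4))) .skip)))))

/-- A vertex missing from the last set starts a new class and doubles the list; otherwise its class
is already present. Doubling addresses rows up to twice the current length, whence `2 * B ≤ Z`. -/
theorem runs_listProg {G : SimpleGraph (Fin n)} {Z B : ℕ} {s : State} (hG : HoldsGraph G s)
    (hn : n ≤ Z) (hB : ∀ m N X, ListsTwinClosed G m N X → N ≤ B) (hZ : 2 * B ≤ Z)
    (hs : rowSet n s 0 = ∅) :
    Runs Z listProg s fun s' => ListsTwinClosed G n (s'.reg 1) (rowSet n s') := by
  have h0 := hG.size
  refine .seq (.const (.forLoop (fun j s' => ListsTwinClosed G j (s'.reg 1) (rowSet n s'))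
    (by decide) (by decide) (by decide) (by simpa [h0] using hn)
    (fun j s m h => by simpa using h)
    (by simpa using listsTwinClosed_one G (X := rowSet n s) hs)
    (fun j s₁ hjn h2 hr₁ ha₁ hI₁ => ?_) fun s' _ _ h => ?_))
  · have hjn : j < n := by simpa [h0] using hjn
    have e0 : s₁.reg 0 = s.reg 0 := by rw [hr₁ 0 (by decide)]; simp
    have e15 : s₁.reg 15 = s.reg 15 := by rw [hr₁ 15 (by decide)]; simp
    have a0 : s₁.arr 0 = s.arr 0 := by rw [ha₁ 0 (by decide)]; simp
    have hG₁ := hG.congr e0 e15 a0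
    have hNB := hB _ _ _ hI₁
    have hN := hI₁.pos
    refine .seq (.copy (.seq (.pred (.seq (.load2 (by decide) (by decide) (m := n)
      (k := s₁.reg 1 - 1) (l := j) (v := s₁.arr 3 ((s₁.reg 1 - 1) * n + j))
      (by simp [hG₁.size]) (by simp) (by simp [h2]) rfl hn
      (by omega) (by omega) fun b c d => .ite (fun ht => .seq (.copy ?_)) fun ht => .skip ?_)))))
    · simp [Test.Holds, hG₁.zero] at ht
      have hv : (⟨j, hjn⟩ : Fin n) ∉ rowSet n s₁ (s₁.reg 1 - 1) := by
        rw [mem_rowSet]; simpa using ht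
      refine .seq (.forLoop (fun i s' => s'.reg 4 = s₁.reg 1 + i ∧
        (∀ l < s₁.reg 1, rowSet n s' l = rowSet n s₁ l) ∧ ∀ l < i, ∀ u,
          u ∈ rowSet n s' (s₁.reg 1 + l) ↔ Twins G u ⟨j, hjn⟩ ∨ u ∈ rowSet n s₁ l)
        (by decide) (by decide) (by decide) (by simp; omega)
        (fun i s m h => by simpa using h)
        ⟨by simp, fun l _ => rfl, fun l hl => absurd hl (Nat.not_lt_zero _)⟩
        (fun i s₂ hi h3 hr₂ ha₂ hI₂ => ?_) fun s₂ hr₂ ha₂ hI₂ => .copy ?_)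
      · have hi : i < s₁.reg 1 := by simpa using hi
        have hG₂ : HoldsGraph G s₂ := hG₁.congr (by rw [hr₂ 0 (by decide)]; simp)
          (by rw [hr₂ 15 (by decide)]; simp) (by rw [ha₂ 0 (by decide)]; simp)
        have d2 : s₂.reg 2 = j := by rw [hr₂ 2 (by decide)]; simp [h2]
        refine .seq ((runs_unionProg hG₂ hn (v := ⟨j, hjn⟩) d2 (by omega)
          (by rw [hI₂.1]; omega) (by rw [hI₂.1]; omega)).frame fun s₃ hr₃ ha₃ h₃ => .succ ?_)
        rw [hI₂.1, h3] at h₃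
        refine ⟨by rw [hr₃ 4 (by decide), hI₂.1]; simp [add_assoc], fun l hl => ?_,
          fun l hl u => ?_⟩
        · rw [rowSet_setReg, h₃.2 l (by omega), hI₂.2.1 l hl]
        · rw [rowSet_setReg]
          rcases Nat.lt_succ_iff_lt_or_eq.1 hl with hl | rfl
          · rw [h₃.2 _ (by omega), hI₂.2.2 l hl]
          · rw [h₃.1, hI₂.2.1 l hi]
      · simp only [State.reg_setReg] at hI₂
        norm_num at hI₂
        have := hI₁.double (v := ⟨j, hjn⟩) hv hI₂.2.1 hI₂.2.2
        simpa [hI₂.1] using this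
    · simp [Test.Holds, hG₁.zero] at ht
      have := hI₁.skip fun u hu => by rw [mem_rowSet, hu]; exact ht
      simpa using this
  · simpa [h0] using h

/-- Compute the best orderings of all listed sets in array `2`. -/
def searchProg : Prog :=
  forLoop 3 1 (.seq (.copy 16 1) (.seq (.copy 17 3) (.seq (.copy 18 3) (.seq arrangeProg
    (forLoop 4 3 (.seq (.copy 16 4) (.seq (.copy 18 1) (.seq arrangeProg
      (.seq (.copy 16 1) (.seq costProg (.seq (.copy 12 11) (.seq (.copy 16 3) (.seq costProg
        (.ite (.lt 12 11) (.seq (.copy 16 4) (.seq (.copy 18 3) arrangeProg))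
          .skip))))))))))))))

/-- Row `reg 1` of array `2` lies just beyond the list and holds the candidates. Its first content
is immaterial, since `arrange` makes a partial ordering of anything. All `j < i` are tried without
an inclusion test, because every candidate is a valid ordering of the set. -/
theorem runs_searchProg {G : SimpleGraph (Fin n)} {Z : ℕ} {s : State} (hG : HoldsGraph G s)
    (hn : n ≤ Z) (h1 : s.reg 1 ≤ Z) :
    Runs Z searchProg s fun s' => ∀ i < s.reg 1, IsPartialOrdering (rowSet n s i) (row n s' i) ∧
      ∀ j < i, pairCost G (row n s' i) ≤ pairCost G (arrange (rowSet n s i) (row n s' j)) := by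
  refine .forLoop (fun N s' => ∀ i < N, IsPartialOrdering (rowSet n s i) (row n s' i) ∧
      ∀ j < i, pairCost G (row n s' i) ≤ pairCost G (arrange (rowSet n s i) (row n s' j)))
    (by decide) (by decide) (by decide) h1
    (fun i s m h => by simpa using h) (fun i hi => absurd hi (Nat.not_lt_zero _))
    (fun i s₁ hi h3 hr₁ ha₁ hI₁ => ?_) fun s' _ _ h => h
  have e1 : s₁.reg 1 = s.reg 1 := hr₁ 1 (by decide)
  have hG₁ : HoldsGraph G s₁ :=
    hG.congr (hr₁ 0 (by decide)) (hr₁ 15 (by decide)) (ha₁ 0 (by decide))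
  have a3 : s₁.arr 3 = s.arr 3 := ha₁ 3 (by decide)
  refine .seq (.copy (.seq (.copy (.seq (.copy (.seq ((runs_arrangeProg (n := n)
    (by simp [hG₁.size]) (by simp [hG₁.zero]) hn (by simp; omega) (by simp; omega) (by simp; omega)
    (by simp; omega)).frame fun s₂ hr₂ ha₂ h₂ => ?_)))))))
  simp [h3] at h₂
  rw [rowSet_congr a3] at h₂
  have d0 : s₂.reg 0 = n := by rw [hr₂ 0 (by decide)]; simp [hG₁.size]
  have d1 : s₂.reg 1 = s.reg 1 := by rw [hr₂ 1 (by decide)]; simp [e1]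
  have d3 : s₂.reg 3 = i := by rw [hr₂ 3 (by decide)]; simp [h3]
  have d15 : s₂.reg 15 = 0 := by rw [hr₂ 15 (by decide)]; simp [hG₁.zero]
  have d17 : s₂.reg 17 = i := by rw [hr₂ 17 (by decide)]; simp [h3]
  have b0 : s₂.arr 0 = s.arr 0 := by rw [ha₂ 0 (by decide)]; exact ha₁ 0 (by decide)
  have b3 : s₂.arr 3 = s.arr 3 := by rw [ha₂ 3 (by decide)]; exact a3
  refine .forLoop (fun j s' => (∀ l < i, row n s' l = row n s₁ l) ∧
      IsPartialOrdering (rowSet n s i) (row n s' i) ∧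
      ∀ l < j, pairCost G (row n s' i) ≤ pairCost G (arrange (rowSet n s i) (row n s₁ l)))
    (by decide) (by decide) (by decide) (by omega) (fun i s m h => by simpa using h)
    ⟨fun l hl => h₂.2 l (by omega), by rw [h₂.1]; exact isPartialOrdering_arrange _ _,
      fun i hi => absurd hi (Nat.not_lt_zero _)⟩
    (fun j s₃ hj h4 hr₃ ha₃ hI₃ => ?_) fun s₃ _ _ hI₃ l hl => ?_
  · rw [d3] at hj
    have f0 : s₃.reg 0 = n := by rw [hr₃ 0 (by decide), d0]
    have f1 : s₃.reg 1 = s.reg 1 := by rw [hr₃ 1 (by decide), d1]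
    have f3 : s₃.reg 3 = i := by rw [hr₃ 3 (by decide), d3]
    have f15 : s₃.reg 15 = 0 := by rw [hr₃ 15 (by decide), d15]
    have f17 : s₃.reg 17 = i := by rw [hr₃ 17 (by decide), d17]
    have c0 : s₃.arr 0 = s.arr 0 := by rw [ha₃ 0 (by decide), b0]
    have c3 : s₃.arr 3 = s.arr 3 := by rw [ha₃ 3 (by decide), b3]
    refine .seq (.copy (.seq (.copy (.seq ((runs_arrangeProg (n := n) (by simp [f0])
      (by simp [f15]) hn (by simp; omega) (by simp; omega) (by simp; omega)
      (by simp; omega)).frame fun s₄ hr₄ ha₄ h₄ => .seq (.copy ?_))))))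
    simp [h4, f1, f17] at h₄
    rw [rowSet_congr c3, hI₃.1 j hj] at h₄
    have g0 : s₄.reg 0 = n := by rw [hr₄ 0 (by decide)]; simp [f0]
    have g1 : s₄.reg 1 = s.reg 1 := by rw [hr₄ 1 (by decide)]; simp [f1]
    have g3 : s₄.reg 3 = i := by rw [hr₄ 3 (by decide)]; simp [f3]
    have g4 : s₄.reg 4 = j := by rw [hr₄ 4 (by decide)]; simp [h4]
    have g15 : s₄.reg 15 = 0 := by rw [hr₄ 15 (by decide)]; simp [f15]
    have g17 : s₄.reg 17 = i := by rw [hr₄ 17 (by decide)]; simp [f17]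
    have k0 : s₄.arr 0 = s.arr 0 := by rw [ha₄ 0 (by decide)]; exact c0
    have k3 : s₄.arr 3 = s.arr 3 := by rw [ha₄ 3 (by decide)]; exact c3
    have hN := h₄.1
    have hi' : row n s₄ i = row n s₃ i := h₄.2 i (by omega)
    refine .seq ((runs_costProg (G := G) (Z := Z)
      (hG.congr (by simp [g0, hG.size]) (by simp [g15, hG.zero]) (by exact k0)) hn (by simp; omega)
      (fun u => ?_)).frame fun s₅ hr₅ ha₅ h₅ => .seq (.copy (.seq (.copy ?_))))
    · rw [row_setReg]
      simp only [State.reg_setReg, if_true, g1, hN]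
      exact ((isPartialOrdering_arrange _ _).le u).trans hn
    simp [g1] at h₅
    rw [hN] at h₅
    have m0 : s₅.reg 0 = n := by rw [hr₅ 0 (by decide)]; simp [g0]
    have m3 : s₅.reg 3 = i := by rw [hr₅ 3 (by decide)]; simp [g3]
    have m4 : s₅.reg 4 = j := by rw [hr₅ 4 (by decide)]; simp [g4]
    have m15 : s₅.reg 15 = 0 := by rw [hr₅ 15 (by decide)]; simp [g15]
    have m17 : s₅.reg 17 = i := by rw [hr₅ 17 (by decide)]; simp [g17]
    have q0 : s₅.arr 0 = s.arr 0 := by rw [ha₅ 0 (by decide)]; exact k0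
    have q2 : s₅.arr 2 = s₄.arr 2 := by rw [ha₅ 2 (by decide)]; simp
    have q3 : s₅.arr 3 = s.arr 3 := by rw [ha₅ 3 (by decide)]; exact k3
    refine .seq ((runs_costProg (G := G) (Z := Z)
      (hG.congr (by simp [m0, hG.size]) (by simp [m15, hG.zero]) (by exact q0)) hn (by simp; omega)
      (fun u => ?_)).frame fun s₆ hr₆ ha₆ h₆ => ?_)
    · rw [row_setReg, row_setReg, row_congr (s := s₄) q2]
      simp only [State.reg_setReg]
      norm_num [m3]
      rw [hi']
      exact (hI₃.2.1.le u).trans hn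
    simp [m3] at h₆
    rw [row_congr (s := s₄) q2, hi'] at h₆
    have o0 : s₆.reg 0 = n := by rw [hr₆ 0 (by decide)]; simp [m0]
    have o3 : s₆.reg 3 = i := by rw [hr₆ 3 (by decide)]; simp [m3]
    have o4 : s₆.reg 4 = j := by rw [hr₆ 4 (by decide)]; simp [m4]
    have o12 : s₆.reg 12 = s₅.reg 11 := by rw [hr₆ 12 (by decide)]; simp
    have o15 : s₆.reg 15 = 0 := by rw [hr₆ 15 (by decide)]; simp [m15]
    have o17 : s₆.reg 17 = i := by rw [hr₆ 17 (by decide)]; simp [m17]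
    have r2 : s₆.arr 2 = s₄.arr 2 := by rw [ha₆ 2 (by decide)]; simp [q2]
    have r3 : s₆.arr 3 = s.arr 3 := by rw [ha₆ 3 (by decide)]; exact q3
    have hrow : ∀ l < i, row n s₆ l = row n s₁ l := fun l hl => by
      rw [row_congr r2, h₄.2 l (by omega), hI₃.1 l hl]
    refine .ite (fun ht => .seq (.copy (.seq (.copy ((runs_arrangeProg (n := n) (by simp [o0])
      (by simp [o15]) hn (by simp; omega) (by simp; omega) (by simp; omega)
      (by simp; omega)).frame fun s₇ hr₇ ha₇ h₇ => ?_))))) fun ht => .skip ?_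
    · simp only [Test.Holds, o12, h₅, h₆] at ht
      simp [o3, o4, o17] at h₇
      rw [rowSet_congr r3, hrow j hj] at h₇
      refine ⟨fun l hl => (h₇.2 l (by omega)).trans (hrow l hl),
        by rw [h₇.1]; exact isPartialOrdering_arrange _ _, fun l hl => ?_⟩
      rw [h₇.1]
      rcases Nat.lt_succ_iff_lt_or_eq.1 hl with hl | rfl
      · exact ht.le.trans (hI₃.2.2 l hl)
      · exact le_rfl
    · simp only [Test.Holds, o12, h₅, h₆, not_lt] at ht
      have hsi : row n s₆ i = row n s₃ i := by rw [row_congr r2, hi']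
      refine ⟨hrow, by rw [hsi]; exact hI₃.2.1, fun l hl => ?_⟩
      rw [hsi]
      rcases Nat.lt_succ_iff_lt_or_eq.1 hl with hl | rfl
      · exact hI₃.2.2 l hl
      · exact ht
  · rw [d3] at hI₃
    rcases Nat.lt_succ_iff_lt_or_eq.1 hl with hl | rfl
    · rw [hI₃.1 l hl]
      exact ⟨(hI₁ l hl).1, fun j hj => by rw [hI₃.1 j (hj.trans hl)]; exact (hI₁ l hl).2 j hj⟩
    · exact ⟨hI₃.2.1, fun j hj => by rw [hI₃.1 j hj]; exact hI₃.2.2 j hj⟩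

end RAM

/-! ### The whole program and the estimates of its running time. -/

namespace RAM

open Classical Finset MSVC

variable {n : ℕ}

/-- Copy the last row of array `2` to array `1`, counting the locations from `1`. -/
def outputProg : Prog :=
  .seq (.copy 11 1) (.seq (.pred 11) (forLoop 5 0 (.seq (load2 7 2 11 5)
    (.seq (.succ 7) (.store 1 5 7)))))

theorem runs_outputProg {Z : ℕ} {s : State} (h0 : s.reg 0 = n) (hn : n ≤ Z) (h1 : s.reg 1 ≤ Z) :
    Runs Z outputProg s fun s' => ∀ v : Fin n, s'.arr 1 v = row n s (s.reg 1 - 1) v + 1 := by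
  refine .seq (.copy (.seq (.pred (.forLoop (fun j s' => ∀ v : Fin n, (v : ℕ) < j →
      s'.arr 1 v = row n s (s.reg 1 - 1) v + 1)
    (by decide) (by decide) (by decide) (by simpa [h0] using hn) (fun _ _ _ h => h)
    (fun v hv => absurd hv (Nat.not_lt_zero _)) (fun j s₁ hj h5 hr₁ ha₁ hI₁ => ?_)
    fun s' _ _ h v => h v (by simp [h0])))))
  have hj : j < n := by simpa [h0] using hj
  have e0 : s₁.reg 0 = n := by rw [hr₁ 0 (by decide)]; simp [h0]
  have e11 : s₁.reg 11 = s.reg 1 - 1 := by rw [hr₁ 11 (by decide)]; simp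
  have a2 : s₁.arr 2 = s.arr 2 := by rw [ha₁ 2 (by decide)]; simp
  refine .seq (.load2 (by decide) (by decide) e0 e11 h5
    (v := row n s (s.reg 1 - 1) ⟨j, hj⟩) (by rw [a2]; rfl) hn (by omega) (by omega)
    fun b c d => .seq (.succ (.store fun v hv => ?_)))
  simp only [State.arr_setArr, State.arr_setReg, State.reg_setReg]
  norm_num [h5]
  split_ifs with h
  · rw [show v = ⟨j, hj⟩ from Fin.ext h]
  · exact hI₁ v (by omega)

/-- The program that computes a minimum sum vertex cover. -/
def msvcProg : Prog := .seq listProg (.seq searchProg outputProg)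

theorem holdsGraph_inputState (G : SimpleGraph (Fin n)) : HoldsGraph G (inputState G) := by
  refine ⟨by simp [inputState], by simp [inputState], fun u v => ?_⟩
  have h : (∃ i j : Fin n, (u : ℕ) * n + v = (i : ℕ) * n + j ∧ G.Adj i j) ↔ G.Adj u v := by
    constructor
    · rintro ⟨i, j, h, hij⟩
      obtain ⟨h1, rfl⟩ := entry_inj h
      rwa [Fin.ext h1]
    · exact fun h => ⟨u, v, rfl, h⟩
  simp [inputState, h]

theorem runs_msvcProg (G : SimpleGraph (Fin n)) {Z B : ℕ} (hn : n ≤ Z)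
    (hB : ∀ m N X, ListsTwinClosed G m N X → N ≤ B) (hZ : 2 * B ≤ Z) :
    Runs Z msvcProg (inputState G) fun s =>
      ∃ φ : Fin n ≃ Fin n, Outputs s φ ∧ IsOptimal G φ := by
  have hG := holdsGraph_inputState G
  refine .seq ((runs_listProg hG hn hB hZ ?_).frame fun s₁ hr₁ ha₁ h₁ => ?_)
  · ext u; simp [mem_rowSet, inputState]
  have hG₁ := hG.congr (hr₁ 0 (by decide)) (hr₁ 15 (by decide)) (ha₁ 0 (by decide))
  have hN := hB _ _ _ h₁
  refine .seq ((runs_searchProg hG₁ hn (by omega)).frame fun s₂ hr₂ ha₂ h₂ => ?_)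
  have d1 : s₂.reg 1 = s₁.reg 1 := hr₂ 1 (by decide)
  refine (runs_outputProg ((hr₂ 0 (by decide)).trans hG₁.size) hn (by omega)).frame
    fun s₃ _ _ h₃ => ?_
  obtain ⟨φ, hφ, ho⟩ := h₁.exists_optimal (fun i hi => (h₂ i hi).1) fun i hi => (h₂ i hi).2
  exact ⟨φ, fun v => by rw [h₃ v, d1, hφ v], ho⟩

/-- An exponential function of `2 ^ k` is bounded by `(k + 1) ^ 2 ^ k` up to a constant. -/
theorem exists_pow_le_factorial_mul (b : ℕ) (hb : 1 ≤ b) :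
    ∃ C : ℕ, ∀ k : ℕ, b ^ (k + 2 ^ k) ≤ C * (k.factorial * (k + 1) ^ 2 ^ k) := by
  -- The constant covers `k ≤ b ^ 2`. Beyond that, `k + 2 ^ k ≤ 2 * 2 ^ k` and `b ^ 2 ≤ k + 1`
  -- suffice.
  refine ⟨b ^ (b ^ 2 + 2 ^ b ^ 2), fun k => ?_⟩
  have h1 : 1 ≤ k.factorial := k.factorial_pos
  have h2 : 1 ≤ b ^ (b ^ 2 + 2 ^ b ^ 2) := Nat.one_le_pow _ _ hb
  have h3 : 1 ≤ (k + 1) ^ 2 ^ k := Nat.one_le_pow _ _ (by omega)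
  rcases le_total k (b ^ 2) with hk | hk
  · calc b ^ (k + 2 ^ k) ≤ b ^ (b ^ 2 + 2 ^ b ^ 2) :=
        Nat.pow_le_pow_right hb (Nat.add_le_add hk (Nat.pow_le_pow_right two_pos hk))
      _ ≤ _ := Nat.le_mul_of_pos_right _ (Nat.mul_pos h1 h3)
  · calc b ^ (k + 2 ^ k) ≤ b ^ (2 * 2 ^ k) := Nat.pow_le_pow_right hb (by
          have := k.lt_two_pow_self
          omega)
      _ = (b ^ 2) ^ 2 ^ k := pow_mul _ _ _
      _ ≤ (k + 1) ^ 2 ^ k := Nat.pow_le_pow_left (by omega) _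
      _ ≤ k.factorial * (k + 1) ^ 2 ^ k := Nat.le_mul_of_pos_left _ h1
      _ ≤ _ := Nat.le_mul_of_pos_left _ h2

/-- The factor `2 ^ e` is needed only for `k = 0`, where the double exponential is constant. -/
theorem two_pow_pow_le (e k : ℕ) :
    (2 ^ e) ^ (k + 2 ^ k) ≤ 2 ^ e * 2 ^ 2 ^ ((e + 2) * k) := by
  rw [← pow_mul, ← pow_add]
  refine Nat.pow_le_pow_right two_pos ?_
  rcases Nat.eq_zero_or_pos k with rfl | hk
  · simp
  · have h1 : e ≤ 2 ^ (e * k) :=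
      e.lt_two_pow_self.le.trans (Nat.pow_le_pow_right two_pos (Nat.le_mul_of_pos_right _ hk))
    have h2 : k + 2 ^ k ≤ 2 ^ (2 * k) := by
      have h3 := k.lt_two_pow_self
      have h4 : 2 ^ 1 ≤ 2 ^ k := Nat.pow_le_pow_right two_pos hk
      rw [two_mul, pow_add]
      nlinarith
    calc e * (k + 2 ^ k) ≤ 2 ^ (e * k) * 2 ^ (2 * k) := Nat.mul_le_mul h1 h2
      _ = 2 ^ ((e + 2) * k) := by rw [← pow_add, add_mul]
      _ ≤ _ := Nat.le_add_left _ _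

end RAM

theorem mainTheorem1 :
    -- one program, one set of constants, all graphs
    (∃ (P : RAM.Prog) (C c d : ℕ), ∀ (n : ℕ) (G : SimpleGraph (Fin n)) (k : ℕ),
      G.vertexCoverNum = (k : ℕ∞) →
        ∃ (s : RAM.State) (t : ℕ),
          RAM.Exec P (RAM.inputState G) s t ∧
          (∃ φ : Fin n ≃ Fin n, RAM.Outputs s φ ∧ MSVC.IsOptimal G φ) ∧
          (t : ℝ) ≤ C * (((k.factorial : ℕ) : ℝ) * ((k : ℝ) + 1) ^ (2 ^ k) + (1.2738 : ℝ) ^ k)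
            * ((n : ℝ) + 1) ^ c ∧
          (t : ℝ) ≤ C * (2 : ℝ) ^ (2 ^ (d * k)) * ((n : ℝ) + 1) ^ c) ∧
    -- some configuration leads only to optimal orderings
    (∀ (n : ℕ) (G : SimpleGraph (Fin n)) (S : Finset (Fin n)),
      G.IsVertexCover (S : Set (Fin n)) → (S.card : ℕ∞) = G.vertexCoverNum →
        ∃ (σ : S ≃ Fin S.card) (b : Set S → Fin (S.card + 1)),
          (∃ φ : Fin n ≃ Fin n, MSVC.Realizes G S σ b φ) ∧
          ∀ φ : Fin n ≃ Fin n, MSVC.Realizes G S σ b φ → MSVC.IsOptimal G φ) := by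
  constructor
  · obtain ⟨e, he⟩ : ∃ e, RAM.msvcProg.size = e := ⟨_, rfl⟩
    obtain ⟨C, hC⟩ := RAM.exists_pow_le_factorial_mul (2 ^ e) Nat.one_le_two_pow
    -- The `5` comes from `2 * B + n + 3 ≤ 5 * B * (n + 1)`; `C` serves the factorial bound and `2 ^
    -- e` the double exponential one. The minimum cover enters only through the bound on the number
    -- of listed sets.
    refine ⟨RAM.msvcProg, 5 ^ e * (C + 2 ^ e), e, e + 2, fun n G k hk => ?_⟩
    obtain ⟨A, hA, hcov⟩ := G.vertexCoverNum_exists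
    classical
    have hS : G.IsVertexCover (A.toFinset : Set (Fin n)) := by simpa using hcov
    have hSk : A.toFinset.card = k := by
      rw [hk, Set.encard_eq_coe_toFinset_card] at hA
      exact_mod_cast hA
    set B := 2 ^ (k + 2 ^ k) with hBdef
    have hB1 : 1 ≤ B := Nat.one_le_two_pow
    obtain ⟨s, t, hexec, ht, hout⟩ := RAM.runs_msvcProg G (Z := 2 * B + n) (B := B) (by omega)
      (fun m N X h => h.le_two_pow hS hSk) (by omega)
    have ht' : t ≤ 5 ^ e * (2 ^ e) ^ (k + 2 ^ k) * (n + 1) ^ e :=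
      calc t ≤ (2 * B + n + 3) ^ e := he ▸ ht.trans (RAM.Prog.timeBound_le _ _)
        _ ≤ (5 * B * (n + 1)) ^ e := Nat.pow_le_pow_left (by nlinarith) e
        _ = _ := by rw [mul_pow, mul_pow, hBdef, ← pow_mul, ← pow_mul, mul_comm (k + 2 ^ k) e]
    have hb1 : t ≤ 5 ^ e * (C + 2 ^ e) * (k.factorial * (k + 1) ^ 2 ^ k) * (n + 1) ^ e := by
      refine ht'.trans (Nat.mul_le_mul_right _ ?_)
      rw [mul_assoc]
      refine Nat.mul_le_mul_left _ ((hC k).trans (Nat.mul_le_mul_right _ (Nat.le_add_right _ _)))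
    have hb2 : t ≤ 5 ^ e * (C + 2 ^ e) * 2 ^ 2 ^ ((e + 2) * k) * (n + 1) ^ e := by
      refine ht'.trans (Nat.mul_le_mul_right _ ?_)
      rw [mul_assoc]
      exact Nat.mul_le_mul_left _
        ((RAM.two_pow_pow_le e k).trans (Nat.mul_le_mul_right _ (Nat.le_add_left _ _)))
    refine ⟨s, t, hexec, hout, ?_, by exact_mod_cast hb2⟩
    have hb3 : (t : ℝ) ≤ ((5 ^ e * (C + 2 ^ e) : ℕ) : ℝ) *
        ((k.factorial : ℝ) * ((k : ℝ) + 1) ^ 2 ^ k) * ((n : ℝ) + 1) ^ e := by exact_mod_cast hb1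
    refine hb3.trans ?_
    gcongr
    -- The first summand already bounds the time, as no vertex cover is computed; the term `1.2738 ^
    -- k` is only added.
    exact le_add_of_nonneg_right (by positivity)
  · intro n G S hS _
    obtain ⟨σ, b, φ, hφ, ho⟩ := MSVC.exists_realizes_optimal (Fintype.card_fin n) G S hS
    exact ⟨σ, b, ⟨φ, hφ⟩, fun ψ hψ => hφ.isOptimal hS ho hψ⟩
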